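/- A tropical curve $\Gamma$ is the metric graph obtained from a finite connected nonempty multigraph (loops allowed) with edge lengths in $\mathbb R_{>0}\cup\{\infty\}$, where length $\infty$ is allowed only on leaf edges, by identifying each edge $e$ with $[0,l(e)]$ (the interval $[0,\infty]$ is the one-point compactification of $[0,\infty)$; for $l(e)=\infty$ a leaf end of $e$ is identified with $\infty$). The points identified with $\infty$ are the points at infinity; their set is $\Gamma_\infty$, and the other points are called finite. $\operatorname{Rat}(\Gamma)$ is the set of rational functions on $\Gamma$, i.e. continuous maps $\Gamma\to\mathbb R\cup\{\pm\infty\}$ that are either constantly $-\infty$, or piecewise affine with integer slopes and finitely many pieces, taking the values $\pm\infty$ only at points at infinity. It is a semiring under pointwise maximum $\oplus$ and pointwise sum $\odot$ (taken at finite points and extended continuously to $\Gamma_\infty$); a semiring isomorphism is a bijection compatible with these operations. For $f\in\operatorname{Rat}(\Gamma)\setminus\{-\infty\}$ a point $x$ is a zero (resp. pole) of $f$ if the sum of the outgoing slopes of $f$ at $x$ is positive (resp. negative), and its degree is the absolute value of this sum; at a point at infinity the outgoing slope is minus the slope with which $f$ approaches that point. For $S\subset\Gamma$ closed and $l\in(0,\infty]$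 put $\operatorname{CF}(S;l)(x):=-\min(l,\operatorname{dist}(x,S))$. For $r\in\mathbb R_{>0}$, an $r$-expansive map $\Gamma_1\to\Gamma_2$ is a continuous bijection that restricts to a bijection $\Gamma_1\setminus\Gamma_{1\infty}\to\Gamma_2\setminus\Gamma_{2\infty}$ multiplying all distances by $r$. **Corollary 3.** Let $\Gamma_1,\Gamma_2$ be tropical curves and $\psi:\operatorname{Rat}(\Gamma_1)\to\operatorname{Rat}(\Gamma_2)$ a semiring isomorphism. Then $\psi(1)$ (the image of the constant function with value $1$) is a constant function with value $r\in\mathbb R_{>0}$, and there is a unique map $\varphi:\Gamma_1\to\Gamma_2$ induced by $\psi$, meaning: (i) for every finite point $x$ of $\Gamma_1$, $\varphi(x)$ is finite and $\psi(\operatorname{CF}(\{x\};\varepsilon))=\operatorname{CF}(\{\varphi(x)\};r\varepsilon)$ for some $\varepsilon>0$; (ii) for every $x\in\Gamma_{1\infty}$, $\varphi(x)\in\Gamma_{2\infty}$ and there is a finite point $y$ on the edge incident to $x$ such that $\varphi(y)$ is a finite point on the edge incident to $\varphi(x)$ and $\psi(\operatorname{CF}(\Gamma_1\setminus(y,x];\infty))=\operatorname{CF}(\Gamma_2\setminus(\varphi(y),\varphi(x)];\infty)$.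 This $\varphi$ is $r$-expansive, and for all $f\in\operatorname{Rat}(\Gamma_1)\setminus\{-\infty\}$ and $x\in\Gamma_1$: $x$ is a zero (resp. pole) of $f$ if and only if $\varphi(x)$ is a zero (resp. pole) of $\psi(f)$, and the degrees of $f$ at $x$ and of $\psi(f)$ at $\varphi(x)$ coincide. -/

import Mathlib

open Set Filter Topology
open scoped ENNReal NNReal

universe u v

/-- A finite, connected, nonempty multigraph, possibly with loops.  Every edge has a chosen
source and target; the choice only serves to parametrize the edge. -/
structure FinMultigraph where
  V : Type u
  E : Type v
  [fintypeV : Fintype V]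
  [fintypeE : Fintype E]
  [nonemptyV : Nonempty V]
  src : E → V
  tgt : E → V
  connected : ∀ a b : V, Relation.EqvGen (fun a b => ∃ e, src e = a ∧ tgt e = b) a b

attribute [instance] FinMultigraph.fintypeV FinMultigraph.fintypeE FinMultigraph.nonemptyV

open Classical in
/-- The valence of a vertex; a loop counts twice. -/
noncomputable def FinMultigraph.valence (G : FinMultigraph.{u, v}) (a : G.V) : ℕ :=
  (Finset.univ.filter (fun e => G.src e = a)).card +
    (Finset.univ.filter (fun e => G.tgt e = a)).card

/-- An edge-weighted graph `(G, l)`, i.e. a model of a tropical curve.  An edge `e` is identified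
with `[0, len e]`, where `0` is the source and `len e` the target.  Infinite length is only allowed
for leaf edges, and such an edge is oriented so that its leaf end is identified with `∞`. -/
structure TropicalCurve extends FinMultigraph.{u, v} where
  len : E → ℝ≥0∞
  len_pos : ∀ e, 0 < len e
  leaf_of_len_eq_top : ∀ e, len e = ⊤ →
    src e ≠ tgt e ∧ toFinMultigraph.valence (tgt e) = 1

namespace TropicalCurve

/-- The points of the tropical curve: the vertices and the interior points of the edges. -/
inductive Point (Γ : TropicalCurve.{u, v}) : Type (max u v)
  | vertex (a : Γ.V) : Point Γ
  | inner (e : Γ.E) (t : ℝ≥0∞) (h0 : 0 < t) (h1 : t < Γ.len e) : Point Γ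

variable {Γ : TropicalCurve.{u, v}}

open Classical in
/-- The point of the edge `e` with parameter `t ∈ [0, len e]` (parameters `t > len e` are never
used; there the value is the target). -/
noncomputable def param (e : Γ.E) (t : ℝ≥0∞) : Γ.Point :=
  if h0 : 0 < t then
    if h1 : t < Γ.len e then Point.inner e t h0 h1 else Point.vertex (Γ.tgt e)
  else Point.vertex (Γ.src e)

/-- The quotient topology: a set is open iff its preimage in every closed edge `[0, len e]` is. -/
noncomputable instance : TopologicalSpace Γ.Point :=
  ⨆ e : Γ.E, TopologicalSpace.coinduced (fun t : Icc (0 : ℝ≥0∞) (Γ.len e) => param e t) inferInstance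

/-- The points at infinity. -/
def infinite (Γ : TropicalCurve.{u, v}) : Set Γ.Point :=
  {x | ∃ e, Γ.len e = ⊤ ∧ x = Point.vertex (Γ.tgt e)}

/-- The finite points. -/
def finite (Γ : TropicalCurve.{u, v}) : Set Γ.Point := Γ.infiniteᶜ

/-- `HasPathLength x y ℓ`: there is a path from `x` to `y` of total length `ℓ` that is composed of
finitely many segments, each inside one closed edge.  (In `ℝ≥0∞`, `⊤ - t = ⊤` for `t < ⊤` and
`⊤ - ⊤ = 0`, so `(s - t) + (t - s)` is the length of the segment between `s` and `t`.) -/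
inductive HasPathLength : Γ.Point → Γ.Point → ℝ≥0∞ → Prop
  | refl (x : Γ.Point) : HasPathLength x x 0
  | cons (e : Γ.E) (s t : ℝ≥0∞) (hs : s ≤ Γ.len e) (ht : t ≤ Γ.len e) (y : Γ.Point) (ℓ : ℝ≥0∞)
      (h : HasPathLength (param e t) y ℓ) : HasPathLength (param e s) y (((s - t) + (t - s)) + ℓ)

/-- The distance between two points: the infimum of the lengths of the paths joining them. -/
noncomputable def pdist (x y : Γ.Point) : ℝ≥0∞ := sInf {ℓ | HasPathLength x y ℓ}

/-- The distance of a point to a set. -/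
noncomputable def distTo (x : Γ.Point) (S : Set Γ.Point) : ℝ≥0∞ := ⨅ z ∈ S, pdist x z

/-- `f` is piecewise affine on the edge `e` with integer slopes and finitely many pieces: outside a
finite set `B` of break points, it is affine with integer slope on every interval (bounded or not) of
parameters that avoids `B`. -/
def IsPiecewiseAffineOn (f : Γ.Point → EReal) (e : Γ.E) : Prop :=
  ∃ B : Finset ℝ≥0, ∀ I : Set ℝ≥0, I.OrdConnected → (∀ t ∈ I, (t : ℝ≥0∞) < Γ.len e ∧ t ∉ B) →
    ∃ (m : ℤ) (c : ℝ), ∀ t ∈ I, f (param e t) = (((m : ℝ) * (t : ℝ) + c : ℝ) : EReal)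

theorem leaf_unique {e : Γ.E} (he : Γ.len e = ⊤) (e' : Γ.E) :
    Γ.src e' ≠ Γ.tgt e ∧ (Γ.tgt e' = Γ.tgt e → e' = e) := by
  classical
  obtain ⟨-, h⟩ := Γ.leaf_of_len_eq_top e he
  unfold FinMultigraph.valence at h
  have h2 : 0 < (Finset.univ.filter (fun e' => Γ.tgt e' = Γ.tgt e)).card :=
    Finset.card_pos.2 ⟨e, by simp⟩
  constructor
  · intro hs
    have h1 : 0 < (Finset.univ.filter (fun e' => Γ.src e' = Γ.tgt e)).card :=
      Finset.card_pos.2 ⟨e', by simp [hs]⟩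
    omega
  · intro ht
    have h3 : (Finset.univ.filter (fun e' => Γ.tgt e' = Γ.tgt e)).card ≤ 1 := by omega
    exact Finset.card_le_one.1 h3 e' (by simp [ht]) e (by simp)

theorem param_zero (e : Γ.E) : param e 0 = Point.vertex (Γ.src e) := by
  simp [param]

theorem param_len (e : Γ.E) : param e (Γ.len e) = Point.vertex (Γ.tgt e) := by
  simp [param, Γ.len_pos e]

theorem param_top {e : Γ.E} (he : Γ.len e = ⊤) : param e ⊤ = Point.vertex (Γ.tgt e) := by
  rw [← he, param_len]

theorem param_mem_finite {e : Γ.E} {t : ℝ≥0∞} (ht : t < Γ.len e) : param e t ∈ Γ.finite := by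
  rintro ⟨e', he', h⟩
  unfold param at h
  split_ifs at h with h0
  exact (leaf_unique he' e).1 (Point.vertex.inj h)

theorem continuous_param (e : Γ.E) :
    Continuous (fun t : Icc (0 : ℝ≥0∞) (Γ.len e) => (param e t : Γ.Point)) := by
  rw [continuous_iff_coinduced_le]
  exact le_iSup (fun e : Γ.E =>
    TopologicalSpace.coinduced (fun t : Icc (0 : ℝ≥0∞) (Γ.len e) => param e t) inferInstance) e

theorem isOpen_iff {U : Set Γ.Point} :
    IsOpen U ↔ ∀ e, IsOpen {t : Icc (0 : ℝ≥0∞) (Γ.len e) | param e t ∈ U} := by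
  change IsOpen[⨆ e : Γ.E, _] U ↔ _
  rw [isOpen_iSup_iff]
  rfl

theorem dense_finite (Γ : TropicalCurve.{u, v}) : Dense Γ.finite := by
  intro x
  by_cases hx : x ∈ Γ.finite
  · exact subset_closure hx
  · obtain ⟨e, he, rfl⟩ := not_not.1 hx
    have hc : Continuous (fun t : ℝ≥0∞ => (param e t : Γ.Point)) := by
      have := (continuous_param e).comp
        (f := fun t : ℝ≥0∞ => (⟨t, by simp [he]⟩ : Icc (0 : ℝ≥0∞) (Γ.len e))) (by fun_prop)
      exact this
    have ht : Tendsto (fun t : ℝ≥0∞ => (param e t : Γ.Point)) (𝓝[<] ⊤) (𝓝 (param e ⊤)) :=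
      hc.continuousAt.mono_left nhdsWithin_le_nhds
    rw [param_top he] at ht
    have : (𝓝[<] (⊤ : ℝ≥0∞)).NeBot := nhdsLT_neBot_of_exists_lt ⟨0, ENNReal.zero_lt_top⟩
    refine mem_closure_of_tendsto ht ?_
    filter_upwards [self_mem_nhdsWithin] with t htt
    exact param_mem_finite (by simpa [he] using htt)

theorem tendsto_infinite {e : Γ.E} (he : Γ.len e = ⊤) {h : Γ.Point → EReal} {l : Filter EReal}
    (H : Tendsto (fun t : ℝ≥0∞ => h (param e t)) (𝓝[<] ⊤) l) :
    Tendsto h (𝓝[Γ.finite] (Point.vertex (Γ.tgt e))) l := by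
  intro s hs
  have h1 := H hs
  rw [mem_map, mem_nhdsLT_iff_exists_Ioo_subset' (ENNReal.zero_lt_top)] at h1
  obtain ⟨T, hT, hsub⟩ := h1
  have hT : T < ⊤ := hT
  have hopen : IsOpen {x : Γ.Point | ∃ t, T < t ∧ param e t = x} := by
    rw [isOpen_iff]
    intro e'
    by_cases hee : e' = e
    · subst hee
      have : {t : Icc (0 : ℝ≥0∞) (Γ.len e') | (param e' t : Γ.Point) ∈
          {x : Γ.Point | ∃ t, T < t ∧ param e' t = x}} = {t | T < t.1} := by
        ext ⟨t, ht0, ht1⟩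
        simp only [mem_ofPred_eq]
        constructor
        · rintro ⟨t', htT, heq⟩
          have h0' : 0 < t' := lt_of_le_of_lt zero_le htT
          unfold param at heq
          rw [dif_pos h0'] at heq
          split_ifs at heq with a1 a2 a3 a4 a5
          · cases heq; exact htT
          · exact hT.trans_le (he ▸ not_lt.1 ‹¬ t < Γ.len e'›)
          · exact absurd (Point.vertex.inj heq).symm (leaf_unique he e').1
        · intro htT
          exact ⟨t, htT, rfl⟩
      rw [this]
      exact isOpen_lt continuous_const continuous_subtype_val
    · convert isOpen_empty
      ext ⟨t, ht0, ht1⟩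
      simp only [mem_ofPred_eq, mem_empty_iff_false, iff_false]
      rintro ⟨t', htT, heq⟩
      have h0' : 0 < t' := lt_of_le_of_lt zero_le htT
      unfold param at heq
      rw [dif_pos h0'] at heq
      split_ifs at heq with a1 a2 a3 a4 a5
      · cases heq; exact hee rfl
      · exact hee ((leaf_unique he e').2 (Point.vertex.inj heq).symm)
      · exact (leaf_unique he e').1 (Point.vertex.inj heq).symm
  have hmem : {x : Γ.Point | ∃ t, T < t ∧ param e t = x} ∈ 𝓝 (Point.vertex (Γ.tgt e)) :=
    hopen.mem_nhds ⟨⊤, hT, param_top he⟩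
  change h ⁻¹' s ∈ 𝓝[Γ.finite] (Point.vertex (Γ.tgt e))
  filter_upwards [mem_nhdsWithin_of_mem_nhds hmem, self_mem_nhdsWithin] with x hx hxf
  obtain ⟨t, htT, rfl⟩ := hx
  refine hsub ⟨htT, lt_top_iff_ne_top.2 ?_⟩
  rintro rfl
  exact hxf ⟨e, he, param_top he⟩

theorem tendsto_affine (m : ℤ) (c : ℝ) :
    ∃ y : EReal, Tendsto (fun t : ℝ≥0∞ => (((m : ℝ) * t.toReal + c : ℝ) : EReal)) (𝓝[<] ⊤) (𝓝 y) := by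
  have hto : Tendsto ENNReal.toReal (𝓝[<] (⊤ : ℝ≥0∞)) atTop := by
    rw [tendsto_atTop]
    intro b
    have : Ioo (ENNReal.ofReal b) ⊤ ∈ 𝓝[<] (⊤ : ℝ≥0∞) := Ioo_mem_nhdsLT ENNReal.ofReal_lt_top
    filter_upwards [this] with t ht
    exact (ENNReal.ofReal_le_iff_le_toReal ht.2.ne).1 ht.1.le
  rcases lt_trichotomy m 0 with hm | rfl | hm
  · refine ⟨⊥, EReal.tendsto_coe_atBot.comp (tendsto_atBot_add_const_right _ c
      (hto.const_mul_atTop_of_neg (by exact_mod_cast hm)))⟩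
  · exact ⟨c, by simpa using tendsto_const_nhds⟩
  · refine ⟨⊤, EReal.tendsto_coe_atTop.comp (tendsto_atTop_add_const_right _ c
      (hto.const_mul_atTop (by exact_mod_cast hm)))⟩

theorem IsPiecewiseAffineOn.eventually {f : Γ.Point → EReal} {e : Γ.E}
    (hf : IsPiecewiseAffineOn f e) (he : Γ.len e = ⊤) :
    ∃ (m : ℤ) (c : ℝ), ∀ᶠ t : ℝ≥0∞ in 𝓝[<] ⊤,
      f (param e t) = (((m : ℝ) * t.toReal + c : ℝ) : EReal) := by
  obtain ⟨B, hB⟩ := hf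
  obtain ⟨M, hM⟩ := B.exists_le
  obtain ⟨m, c, h⟩ := hB (Ioi M) ordConnected_Ioi
    (fun t ht => ⟨by simp [he], fun htB => not_lt.2 (hM t htB) ht⟩)
  refine ⟨m, c, ?_⟩
  have : Ioo (M : ℝ≥0∞) ⊤ ∈ 𝓝[<] (⊤ : ℝ≥0∞) := Ioo_mem_nhdsLT ENNReal.coe_lt_top
  filter_upwards [this] with t ht
  lift t to ℝ≥0 using ht.2.ne
  exact h t (by simpa using ht.1)

theorem IsPiecewiseAffineOn.congr {f g : Γ.Point → EReal} {e : Γ.E}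
    (hf : IsPiecewiseAffineOn f e) (h : ∀ x ∈ Γ.finite, g x = f x) : IsPiecewiseAffineOn g e := by
  obtain ⟨B, hB⟩ := hf
  refine ⟨B, fun I hI hIB => ?_⟩
  obtain ⟨m, c, hm⟩ := hB I hI hIB
  exact ⟨m, c, fun t ht => by rw [h _ (param_mem_finite (hIB t ht).1), hm t ht]⟩

theorem IsPiecewiseAffineOn.add {f g : Γ.Point → EReal} {e : Γ.E}
    (hf : IsPiecewiseAffineOn f e) (hg : IsPiecewiseAffineOn g e) :
    IsPiecewiseAffineOn (fun x => f x + g x) e := by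
  classical
  obtain ⟨B, hB⟩ := hf
  obtain ⟨C, hC⟩ := hg
  refine ⟨B ∪ C, fun I hI hIB => ?_⟩
  obtain ⟨m, c, hm⟩ := hB I hI (fun t ht => ⟨(hIB t ht).1,
    fun h => (hIB t ht).2 (Finset.mem_union_left _ h)⟩)
  obtain ⟨n, d, hn⟩ := hC I hI (fun t ht => ⟨(hIB t ht).1,
    fun h => (hIB t ht).2 (Finset.mem_union_right _ h)⟩)
  refine ⟨m + n, c + d, fun t ht => ?_⟩
  simp only [hm t ht, hn t ht]
  rw [← EReal.coe_add]
  congr 1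
  push_cast
  ring

theorem IsPiecewiseAffineOn.finite_pieces {f : Γ.Point → EReal} {e : Γ.E}
    (hf : IsPiecewiseAffineOn f e) :
    ∃ (B : Finset ℝ≥0) (F : Finset (ℤ × ℝ)), ∀ I : Set ℝ≥0, I.OrdConnected →
      (∀ t ∈ I, (t : ℝ≥0∞) < Γ.len e ∧ t ∉ B) → I.Nonempty →
      ∃ p ∈ F, ∀ t ∈ I, f (param e t) = (((p.1 : ℝ) * (t : ℝ) + p.2 : ℝ) : EReal) := by
  classical
  obtain ⟨B, hB⟩ := hf
  have key : ∀ S : Finset ℝ≥0, ∃ p : ℤ × ℝ, ∀ t : ℝ≥0, (t : ℝ≥0∞) < Γ.len e → t ∉ B →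
      (∀ b ∈ B, b < t ↔ b ∈ S) → f (param e t) = (((p.1 : ℝ) * (t : ℝ) + p.2 : ℝ) : EReal) := by
    intro S
    obtain ⟨m, c, h⟩ := hB {t | (t : ℝ≥0∞) < Γ.len e ∧ t ∉ B ∧ ∀ b ∈ B, b < t ↔ b ∈ S} (by
      refine ⟨fun x hx y hy z hz => ⟨lt_of_le_of_lt (by exact_mod_cast hz.2) hy.1, ?_, ?_⟩⟩
      · intro hzB
        rcases hz.2.lt_or_eq with h | h
        · have := (hx.2.2 z hzB).2 ((hy.2.2 z hzB).1 h)
          exact not_lt.2 hz.1 this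
        · exact hy.2.1 (h ▸ hzB)
      · intro b hb
        constructor
        · intro h
          exact (hy.2.2 b hb).1 (h.trans_le hz.2)
        · intro h
          exact ((hx.2.2 b hb).2 h).trans_le hz.1) (fun t ht => ⟨ht.1, ht.2.1⟩)
    exact ⟨(m, c), fun t h1 h2 h3 => h t ⟨h1, h2, h3⟩⟩
  choose p hp using key
  refine ⟨B, B.powerset.image p, fun I hI hIB ⟨t₀, ht₀⟩ => ?_⟩
  refine ⟨p (B.filter (fun b => b < t₀)), Finset.mem_image_of_mem _ (by simp), fun t ht => ?_⟩
  refine hp _ t (hIB t ht).1 (hIB t ht).2 (fun b hb => ?_)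
  simp only [Finset.mem_filter, hb, true_and]
  constructor
  · intro h
    by_contra h'
    exact (hIB b (hI.out ht₀ ht ⟨not_lt.1 h', h.le⟩)).2 hb
  · intro h
    by_contra h'
    exact (hIB b (hI.out ht ht₀ ⟨not_lt.1 h', h.le⟩)).2 hb

theorem IsPiecewiseAffineOn.sup {f g : Γ.Point → EReal} {e : Γ.E}
    (hf : IsPiecewiseAffineOn f e) (hg : IsPiecewiseAffineOn g e) :
    IsPiecewiseAffineOn (fun x => max (f x) (g x)) e := by
  classical
  obtain ⟨B, F, hB⟩ := hf.finite_pieces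
  obtain ⟨C, G, hC⟩ := hg.finite_pieces
  let cr : (ℤ × ℝ) × (ℤ × ℝ) → ℝ≥0 := fun q =>
    Real.toNNReal ((q.2.2 - q.1.2) / ((q.1.1 : ℝ) - q.2.1))
  refine ⟨B ∪ C ∪ (F ×ˢ G).image cr, fun I hI hIB => ?_⟩
  rcases I.eq_empty_or_nonempty with rfl | hne
  · exact ⟨0, 0, fun t ht => absurd ht (by simp)⟩
  obtain ⟨⟨m, c⟩, hpF, hm⟩ := hB I hI (fun t ht => ⟨(hIB t ht).1, fun h =>
    (hIB t ht).2 (Finset.mem_union_left _ (Finset.mem_union_left _ h))⟩) hne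
  obtain ⟨⟨n, d⟩, hpG, hn⟩ := hC I hI (fun t ht => ⟨(hIB t ht).1, fun h =>
    (hIB t ht).2 (Finset.mem_union_left _ (Finset.mem_union_right _ h))⟩) hne
  simp only at hm hn
  have hcr : cr ((m, c), (n, d)) ∉ I := fun h =>
    (hIB _ h).2 (Finset.mem_union_right _
      (Finset.mem_image_of_mem _ (Finset.mem_product.2 ⟨hpF, hpG⟩)))
  by_cases h1 : ∀ t ∈ I, (m : ℝ) * t + c ≤ n * t + d
  · refine ⟨n, d, fun t ht => ?_⟩
    simp only [hm t ht, hn t ht]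
    exact max_eq_right (by exact_mod_cast h1 t ht)
  by_cases h2 : ∀ t ∈ I, (n : ℝ) * t + d ≤ m * t + c
  · refine ⟨m, c, fun t ht => ?_⟩
    simp only [hm t ht, hn t ht]
    exact max_eq_left (by exact_mod_cast h2 t ht)
  exfalso
  push Not at h1 h2
  obtain ⟨a, ha, hal⟩ := h1
  obtain ⟨b, hb, hbl⟩ := h2
  have hmn : (m : ℝ) - n ≠ 0 := by
    intro h
    have h : (m : ℝ) = n := by linarith
    rw [h] at hal hbl
    linarith
  have hmem : (d - c) / ((m : ℝ) - n) ∈ uIcc (a : ℝ) b := by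
    rw [mem_uIcc]
    rcases lt_or_gt_of_ne hmn with h | h
    · left
      constructor
      · rw [le_div_iff_of_neg h]; nlinarith
      · rw [div_le_iff_of_neg h]; nlinarith
    · right
      constructor
      · rw [le_div_iff₀ h]; nlinarith
      · rw [div_le_iff₀ h]; nlinarith
  have h0 : 0 ≤ (d - c) / ((m : ℝ) - n) := by
    rcases mem_uIcc.1 hmem with h | h
    · exact a.2.trans h.1
    · exact b.2.trans h.1
  apply hcr
  apply hI.uIcc_subset ha hb
  have hcoe : ((cr ((m, c), (n, d)) : ℝ≥0) : ℝ) = (d - c) / ((m : ℝ) - n) :=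
    Real.coe_toNNReal _ h0
  rw [mem_uIcc] at hmem ⊢
  rw [← hcoe] at hmem
  exact_mod_cast hmem

end TropicalCurve

/-- The rational functions on `Γ`: continuous maps `Γ → ℝ ∪ {±∞}` that are either constantly `-∞`,
or piecewise affine with integer slopes and finitely many pieces, and finite at all finite
points. -/
structure RatFun (Γ : TropicalCurve.{u, v}) where
  toFun : Γ.Point → EReal
  cont : Continuous toFun
  rational : (∀ x, toFun x = ⊥) ∨
    ((∀ x ∈ Γ.finite, toFun x ≠ ⊥ ∧ toFun x ≠ ⊤) ∧
      ∀ e, TropicalCurve.IsPiecewiseAffineOn toFun e)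

namespace RatFun

open TropicalCurve

variable {Γ : TropicalCurve.{u, v}}

instance : CoeFun (RatFun Γ) (fun _ => Γ.Point → EReal) := ⟨RatFun.toFun⟩

theorem ne_top (f : RatFun Γ) {x : Γ.Point} (hx : x ∈ Γ.finite) : f x ≠ ⊤ := by
  rcases f.rational with h | h
  · simp [h x]
  · exact (h.1 x hx).2

@[ext] theorem ext {f g : RatFun Γ} (h : ∀ x, f x = g x) : f = g := by
  cases f; cases g
  congr
  exact funext h

theorem ext_finite {f g : RatFun Γ} (h : ∀ x ∈ Γ.finite, f x = g x) : f = g := by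
  have := Continuous.ext_on (dense_finite Γ) f.cont g.cont h
  exact ext (fun x => congrFun this x)

theorem exists_limit (f g : RatFun Γ) (x : Γ.Point) :
    ∃ y, Tendsto (fun x => f x + g x) (𝓝[Γ.finite] x) (𝓝 y) := by
  by_cases hx : x ∈ Γ.finite
  · refine ⟨f x + g x, Tendsto.mono_left ?_ nhdsWithin_le_nhds⟩
    have h := EReal.continuousAt_add (p := (f x, g x)) (Or.inl (f.ne_top hx)) (Or.inr (g.ne_top hx))
    exact h.tendsto.comp (f.cont.continuousAt.prodMk_nhds g.cont.continuousAt)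
  · obtain ⟨e, he, rfl⟩ := not_not.1 hx
    rcases f.rational with hf | ⟨-, hf⟩
    · exact ⟨⊥, by simpa [hf] using tendsto_const_nhds⟩
    rcases g.rational with hg | ⟨-, hg⟩
    · exact ⟨⊥, by simpa [hg] using tendsto_const_nhds⟩
    obtain ⟨m, c, h⟩ := IsPiecewiseAffineOn.eventually ((hf e).add (hg e)) he
    obtain ⟨y, hy⟩ := tendsto_affine m c
    exact ⟨y, tendsto_infinite he (hy.congr' (h.mono fun t ht => ht.symm))⟩

theorem extend_eq (f g : RatFun Γ) {x : Γ.Point} (hx : x ∈ Γ.finite) :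
    extendFrom Γ.finite (fun x => f x + g x) x = f x + g x := by
  apply extendFrom_eq (subset_closure hx)
  refine Tendsto.mono_left ?_ nhdsWithin_le_nhds
  have h := EReal.continuousAt_add (p := (f x, g x)) (Or.inl (f.ne_top hx)) (Or.inr (g.ne_top hx))
  exact h.tendsto.comp (f.cont.continuousAt.prodMk_nhds g.cont.continuousAt)

/-- The constant function `-∞`. -/
noncomputable def constBot (Γ : TropicalCurve.{u, v}) : RatFun Γ where
  toFun _ := ⊥
  cont := continuous_const
  rational := Or.inl fun _ => rfl

/-- The constant rational function with real value `c`. -/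
noncomputable def const (Γ : TropicalCurve.{u, v}) (c : ℝ) : RatFun Γ where
  toFun _ := (c : EReal)
  cont := continuous_const
  rational := Or.inr ⟨fun _ _ => ⟨EReal.coe_ne_bot _, EReal.coe_ne_top _⟩,
    fun _ => ⟨∅, fun _ _ _ => ⟨0, c, fun _ _ => by simp⟩⟩⟩

/-- The tropical sum: the pointwise maximum. -/
noncomputable def tropAdd (f g : RatFun Γ) : RatFun Γ where
  toFun x := max (f x) (g x)
  cont := f.cont.max g.cont
  rational := by
    rcases f.rational with hf | hf
    · simpa [hf] using g.rational
    rcases g.rational with hg | hg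
    · simpa [hg] using Or.inr hf
    refine Or.inr ⟨fun x hx => ?_, fun e => (hf.2 e).sup (hg.2 e)⟩
    rcases max_choice (f x) (g x) with h | h
    · rw [h]; exact hf.1 x hx
    · rw [h]; exact hg.1 x hx

/-- The tropical product: the pointwise sum on the finite points, extended continuously to the
points at infinity. -/
noncomputable def tropMul (f g : RatFun Γ) : RatFun Γ where
  toFun := extendFrom Γ.finite (fun x => f x + g x)
  cont := continuous_extendFrom (dense_finite Γ) (exists_limit f g)
  rational := by
    have hbot : (∀ x, f x + g x = ⊥) → ∀ x, extendFrom Γ.finite (fun x => f x + g x) x = ⊥ := by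
      intro h x
      apply extendFrom_eq (dense_finite Γ x)
      simpa [h] using tendsto_const_nhds
    rcases f.rational with hf | hf
    · exact Or.inl (hbot fun x => by simp [hf])
    rcases g.rational with hg | hg
    · exact Or.inl (hbot fun x => by simp [hg])
    refine Or.inr ⟨fun x hx => ?_,
      fun e => IsPiecewiseAffineOn.congr ((hf.2 e).add (hg.2 e)) (fun x hx => extend_eq f g hx)⟩
    rw [extend_eq f g hx]
    exact ⟨by simp [EReal.add_eq_bot_iff, (hf.1 x hx).1, (hg.1 x hx).1],
      EReal.add_ne_top (hf.1 x hx).2 (hg.1 x hx).2⟩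

theorem tropMul_apply (f g : RatFun Γ) {x : Γ.Point} (hx : x ∈ Γ.finite) :
    tropMul f g x = f x + g x := extend_eq f g hx

theorem tropAdd_apply (f g : RatFun Γ) (x : Γ.Point) : tropAdd f g x = max (f x) (g x) := rfl

/-- The semiring `Rat(Γ)`: addition is `⊕`, multiplication is `⊙`, the zero is the constant `-∞`
and the one is the constant `0`. -/
noncomputable instance : CommSemiring (RatFun Γ) where
  add := tropAdd
  zero := constBot Γ
  mul := tropMul
  one := const Γ 0
  nsmul := @nsmulRec _ ⟨constBot Γ⟩ ⟨tropAdd⟩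
  npow := @npowRec _ ⟨const Γ 0⟩ ⟨tropMul⟩
  add_assoc f g h := ext fun x => max_assoc _ _ _
  add_comm f g := ext fun x => max_comm _ _
  zero_add f := ext fun x => max_eq_right bot_le
  add_zero f := ext fun x => max_eq_left bot_le
  mul_assoc f g h := ext_finite fun x hx => by
    change tropMul (tropMul f g) h x = tropMul f (tropMul g h) x
    simp only [tropMul_apply _ _ hx, add_assoc]
  mul_comm f g := ext_finite fun x hx => by
    change tropMul f g x = tropMul g f x
    simp only [tropMul_apply _ _ hx, add_comm]
  one_mul f := ext_finite fun x hx => by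
    change tropMul (const Γ 0) f x = f x
    simp [tropMul_apply _ _ hx, const]
  mul_one f := ext_finite fun x hx => by
    change tropMul f (const Γ 0) x = f x
    simp [tropMul_apply _ _ hx, const]
  zero_mul f := ext_finite fun x hx => by
    change tropMul (constBot Γ) f x = constBot Γ x
    simp [tropMul_apply _ _ hx, constBot]
  mul_zero f := ext_finite fun x hx => by
    change tropMul f (constBot Γ) x = constBot Γ x
    simp [tropMul_apply _ _ hx, constBot]
  left_distrib f g h := ext_finite fun x hx => by
    change tropMul f (tropAdd g h) x = tropAdd (tropMul f g) (tropMul f h) x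
    simp only [tropMul_apply _ _ hx, tropAdd_apply]
    exact (max_add_add_left _ _ _).symm
  right_distrib f g h := ext_finite fun x hx => by
    change tropMul (tropAdd f g) h x = tropAdd (tropMul f h) (tropMul g h) x
    simp only [tropMul_apply _ _ hx, tropAdd_apply]
    exact (max_add_add_right _ _ _).symm

/-- `m` is the outgoing slope of `f` at the point with parameter `t` of the edge `e`, in the
direction of increasing parameters. -/
def IsSlopeFwd (f : RatFun Γ) (e : Γ.E) (t : ℝ≥0∞) (m : ℤ) : Prop :=
  ∃ c : ℝ, ∀ᶠ s : ℝ≥0∞ in 𝓝[>] t, f (param e s) = (((m : ℝ) * s.toReal + c : ℝ) : EReal)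

/-- `m` is the outgoing slope of `f` at the point with parameter `t` of the edge `e`, in the
direction of decreasing parameters: minus the slope with which `f` arrives at `t`.  This includes
the points at infinity (`t = ⊤`). -/
def IsSlopeBwd (f : RatFun Γ) (e : Γ.E) (t : ℝ≥0∞) (m : ℤ) : Prop :=
  ∃ c : ℝ, ∀ᶠ s : ℝ≥0∞ in 𝓝[<] t, f (param e s) = ((-(m : ℝ) * s.toReal + c : ℝ) : EReal)

open Classical in
/-- The outgoing slope in the direction of increasing parameters. -/
noncomputable def slopeFwd (f : RatFun Γ) (e : Γ.E) (t : ℝ≥0∞) : ℤ :=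
  if h : ∃ m, IsSlopeFwd f e t m then h.choose else 0

open Classical in
/-- The outgoing slope in the direction of decreasing parameters. -/
noncomputable def slopeBwd (f : RatFun Γ) (e : Γ.E) (t : ℝ≥0∞) : ℤ :=
  if h : ∃ m, IsSlopeBwd f e t m then h.choose else 0

open Classical in
/-- The sum of the outgoing slopes of `f` at a point (meaningful for `f ≠ -∞`). -/
noncomputable def slopeSum (f : RatFun Γ) : Γ.Point → ℤ
  | Point.vertex a =>
      ∑ e ∈ Finset.univ.filter (fun e => Γ.src e = a), slopeFwd f e 0 +
        ∑ e ∈ Finset.univ.filter (fun e => Γ.tgt e = a), slopeBwd f e (Γ.len e)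
  | Point.inner e t _ _ => slopeFwd f e t + slopeBwd f e t

/-- `x` is a zero of `f`. -/
def IsZeroAt (f : RatFun Γ) (x : Γ.Point) : Prop := 0 < slopeSum f x

/-- `x` is a pole of `f`. -/
def IsPoleAt (f : RatFun Γ) (x : Γ.Point) : Prop := slopeSum f x < 0

/-- The degree of a zero or pole `x` of `f`. -/
noncomputable def degreeAt (f : RatFun Γ) (x : Γ.Point) : ℕ := (slopeSum f x).natAbs

/-- `f` is the chip-firing move by `S` and `l`. -/
def IsChipFiring (f : RatFun Γ) (S : Set Γ.Point) (l : ℝ≥0∞) : Prop :=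
  ∀ x, f x = -((min l (distTo x S) : ℝ≥0∞) : EReal)

end RatFun

namespace TropicalCurve

/-- The half-open end `(y, ∞]` of an edge of infinite length, where `y` has parameter `s`. -/
def ray {Γ : TropicalCurve.{u, v}} (e : Γ.E) (s : ℝ≥0) : Set Γ.Point :=
  {x | ∃ t : ℝ≥0∞, (s : ℝ≥0∞) < t ∧ x = param e t}

end TropicalCurve

universe u' v'

/-- `φ` is an `r`-expansive map: a continuous bijection that restricts to a bijection of the finite
points which multiplies distances by `r`. -/
def IsExpansive {Γ₁ : TropicalCurve.{u, v}} {Γ₂ : TropicalCurve.{u', v'}} (r : ℝ)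
    (φ : Γ₁.Point → Γ₂.Point) : Prop :=
  Continuous φ ∧ Function.Bijective φ ∧ (∀ x, x ∈ Γ₁.finite ↔ φ x ∈ Γ₂.finite) ∧
    ∀ x ∈ Γ₁.finite, ∀ y ∈ Γ₁.finite,
      ENNReal.ofReal r * TropicalCurve.pdist x y = TropicalCurve.pdist (φ x) (φ y)

/-- `φ` is the map induced by `ψ`, where `r` is the value of the constant `ψ(1)`: a finite point `x`
goes to the finite point `x'` with `ψ(CF({x}; ε)) = CF({x'}; r ε)` for some `ε > 0`; a point at
infinity `x` goes to the point at infinity `x'` with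
`ψ(CF(Γ₁ ∖ (y, x]; ∞)) = CF(Γ₂ ∖ (y', x']; ∞)` for some finite point `y` on the edge of `x`, where
`y'` corresponds to `y` and lies on the edge of `x'`. -/
def IsInducedMap {Γ₁ : TropicalCurve.{u, v}} {Γ₂ : TropicalCurve.{u', v'}}
    (ψ : RatFun Γ₁ ≃+* RatFun Γ₂) (r : ℝ) (φ : Γ₁.Point → Γ₂.Point) : Prop :=
  (∀ x ∈ Γ₁.finite, φ x ∈ Γ₂.finite ∧ ∃ ε : ℝ, 0 < ε ∧ ∃ g : RatFun Γ₁,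
    g.IsChipFiring {x} (ENNReal.ofReal ε) ∧
      (ψ g).IsChipFiring {φ x} (ENNReal.ofReal (r * ε))) ∧
  (∀ e : Γ₁.E, Γ₁.len e = ⊤ → ∃ e' : Γ₂.E, Γ₂.len e' = ⊤ ∧
    φ (TropicalCurve.Point.vertex (Γ₁.tgt e)) = TropicalCurve.Point.vertex (Γ₂.tgt e') ∧
    ∃ s s' : ℝ≥0, φ (TropicalCurve.param e s) = TropicalCurve.param e' s' ∧
      ∃ g : RatFun Γ₁, g.IsChipFiring (TropicalCurve.ray e s)ᶜ ⊤ ∧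
        (ψ g).IsChipFiring (TropicalCurve.ray e' s')ᶜ ⊤)

/-! A point is determined by the values at it of all rational functions, and `ψ` carries evaluations
to evaluations up to one scaling factor `r`.

Scale. Among the functions other than `-∞`, the real constants are exactly those with `n`-th roots
for `⊙` for every `n > 0`, because a slope divisible by every `n` vanishes
(`exists_eq_const_of_roots`). Hence `ψ` permutes the constants. On them it is additive and, since
`⊕` encodes the order, monotone, so it is multiplication by some `r > 0` (`exists_scale`).

Points. Fix `x`. The sets `{ψ f ≤ 0}` with `f x ≤ 0` are closed and directed, and nonempty because a
positive lower bound of `ψ f` would be one of `f`. By compactness they share a point `x'`. Shifting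
by constants and inverting for `⊙` upgrades this to `ψ f x' = r * f x` for all `f`
(`exists_forall_map_eq`). Rational functions separate points, so the same construction for `ψ⁻¹`
gives the inverse of `φ : x ↦ x'` (`exists_isTransport`).

Metric. Slopes are integers, so a function with strict maximum `0` at a finite point falls off at
least as fast as the distance: it lies below `-min(ε, dist)` for some `ε`
(`exists_le_neg_min_pdist`). Applied to the image of a truncated distance, this bounds the expansion
of `φ` near each finite point by `r`. Chaining along segments makes the bound global, and the
inverse map gives equality (`pdist_map`).

Slopes. `φ` maps small spheres to small spheres and thereby matches the branches at `x` with those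
at `φ x`. Values and distances both scale by `r`, so slopes are preserved. Near a point at infinity
`φ` is affine with slope `r` in the edge parameters, which gives the same conclusion.

Uniqueness holds because `CF({x}; ε)` vanishes only at `x`, and the chip-firing move attached to an
infinite end is `-∞` only at its point at infinity. -/

namespace TropicalCurve

variable {Γ : TropicalCurve.{u, v}}

/-! ### Topology, path metric and piecewise affine functions -/

theorem param_inner {e : Γ.E} {t : ℝ≥0∞} (h0 : 0 < t) (h1 : t < Γ.len e) :
    param e t = Point.inner e t h0 h1 := by
  simp [param, h0, h1]

theorem param_mem_finite_of_ne_top {e : Γ.E} {t : ℝ≥0∞} (ht : t ≤ Γ.len e) (ht' : t ≠ ⊤) :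
    param e t ∈ Γ.finite := by
  rcases ht.lt_or_eq with h | rfl
  · exact param_mem_finite h
  · rintro ⟨e', he', h⟩
    rw [param_len] at h
    have := (leaf_unique he' e).2 (Point.vertex.inj h)
    exact ht' (this ▸ he')

theorem continuous_iff_edgewise {X : Type*} [TopologicalSpace X] {h : Γ.Point → X} :
    Continuous h ↔ ∀ e, Continuous (fun t : Icc (0 : ℝ≥0∞) (Γ.len e) => h (param e t)) := by
  refine ⟨fun hc e => hc.comp (continuous_param e), fun H => ⟨fun U hU => ?_⟩⟩
  rw [isOpen_iff]
  exact fun e => hU.preimage (H e)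

/-- Finitely many compact intervals cover everything but possibly isolated vertices, which are
finite in number. This relies on infinite edges being closed up by their point at infinity, and
supports every later minimum, maximum and intersection argument. -/
instance : CompactSpace Γ.Point := by
  have h : (univ : Set Γ.Point) ⊆ range (Point.vertex (Γ := Γ)) ∪
      ⋃ e, range (fun t : Icc (0 : ℝ≥0∞) (Γ.len e) => (param e t : Γ.Point)) := by
    rintro (a | ⟨e, t, h0, h1⟩) -
    · exact Or.inl ⟨a, rfl⟩
    · exact Or.inr (mem_iUnion.2 ⟨e, ⟨t, h0.le, h1.le⟩, param_inner h0 h1⟩)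
  refine ⟨?_⟩
  rw [← univ_subset_iff.1 h]
  exact (finite_range _).isCompact.union (isCompact_iUnion fun e => isCompact_range (continuous_param e))

theorem HasPathLength.trans {x y z : Γ.Point} {k l : ℝ≥0∞} (h : HasPathLength x y k)
    (h' : HasPathLength y z l) : HasPathLength x z (k + l) := by
  induction h with
  | refl x => simpa using h'
  | cons e s t hs ht y ℓ _ ih =>
    rw [add_assoc]
    exact HasPathLength.cons e s t hs ht _ _ (ih h')

theorem hasPathLength_param {e : Γ.E} {s t : ℝ≥0∞} (hs : s ≤ Γ.len e) (ht : t ≤ Γ.len e) :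
    HasPathLength (param e s : Γ.Point) (param e t) ((s - t) + (t - s)) := by
  simpa using HasPathLength.cons e s t hs ht _ _ (HasPathLength.refl _)

theorem HasPathLength.symm {x y : Γ.Point} {l : ℝ≥0∞} (h : HasPathLength x y l) :
    HasPathLength y x l := by
  induction h with
  | refl x => exact HasPathLength.refl x
  | cons e s t hs ht y ℓ _ ih =>
    rw [add_comm, add_comm (s - t)]
    exact ih.trans (hasPathLength_param ht hs)

theorem pdist_comm (x y : Γ.Point) : pdist x y = pdist y x := by
  unfold pdist
  congr 1
  ext l
  exact ⟨HasPathLength.symm, HasPathLength.symm⟩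

theorem HasPathLength.pdist_le {x y : Γ.Point} {l : ℝ≥0∞} (h : HasPathLength x y l) :
    pdist x y ≤ l := sInf_le h

@[simp] theorem pdist_self (x : Γ.Point) : pdist x x = 0 :=
  nonpos_iff_eq_zero.1 (HasPathLength.refl x).pdist_le

theorem pdist_param_le {e : Γ.E} {s t : ℝ≥0∞} (hs : s ≤ Γ.len e) (ht : t ≤ Γ.len e) :
    pdist (param e s : Γ.Point) (param e t) ≤ (s - t) + (t - s) :=
  (hasPathLength_param hs ht).pdist_le

theorem pdist_triangle (x y z : Γ.Point) : pdist x z ≤ pdist x y + pdist y z := by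
  unfold pdist
  rw [ENNReal.sInf_add]
  refine le_iInf₂ fun k hk => ?_
  rw [ENNReal.add_sInf]
  exact le_iInf₂ fun l hl => sInf_le (HasPathLength.trans hk hl)

/-- A function that is 1-Lipschitz along every edge is 1-Lipschitz. -/
theorem le_add_pdist {h : Γ.Point → ℝ≥0∞}
    (hh : ∀ e s t, s ≤ Γ.len e → t ≤ Γ.len e → h (param e s) ≤ h (param e t) + ((s - t) + (t - s)))
    (x y : Γ.Point) : h x ≤ h y + pdist x y := by
  unfold pdist
  rw [ENNReal.add_sInf]
  refine le_iInf₂ fun l hl => ?_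
  induction hl with
  | refl x => simp
  | cons e s t hs ht y ℓ _ ih =>
    refine (hh e s t hs ht).trans ?_
    exact (add_le_add_left ih _).trans (by rw [add_assoc, add_comm ℓ])

theorem distTo_singleton (x z : Γ.Point) : distTo z {x} = pdist x z := by
  simp [distTo, pdist_comm]

theorem IsPiecewiseAffineOn.neg {f : Γ.Point → EReal} {e : Γ.E} (hf : IsPiecewiseAffineOn f e) :
    IsPiecewiseAffineOn (fun x => -f x) e := by
  obtain ⟨B, hB⟩ := hf
  refine ⟨B, fun I hI hIB => ?_⟩
  obtain ⟨m, c, h⟩ := hB I hI hIB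
  refine ⟨-m, -c, fun t ht => ?_⟩
  simp only [h t ht]
  rw [← EReal.coe_neg]
  congr 1
  push_cast
  ring

/-- Declaring `0` a break point makes the value at the source irrelevant. Edgewise formulas such as
`affine`, whose value at vertices is arbitrary, can therefore serve as comparison functions. -/
theorem IsPiecewiseAffineOn.congr_inner {f g : Γ.Point → EReal} {e : Γ.E}
    (hf : IsPiecewiseAffineOn f e)
    (h : ∀ t : ℝ≥0, 0 < t → (t : ℝ≥0∞) < Γ.len e → g (param e t) = f (param e t)) :
    IsPiecewiseAffineOn g e := by
  classical
  obtain ⟨B, hB⟩ := hf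
  refine ⟨insert 0 B, fun I hI hIB => ?_⟩
  obtain ⟨m, c, hm⟩ := hB I hI
    (fun t ht => ⟨(hIB t ht).1, fun h => (hIB t ht).2 (Finset.mem_insert_of_mem h)⟩)
  refine ⟨m, c, fun t ht => ?_⟩
  rw [h t (pos_iff_ne_zero.2 fun h0 => (hIB t ht).2 (by simp [h0])) (hIB t ht).1, hm t ht]

/-- The function on the edges that is affine in the parameter. -/
noncomputable def affine (m : ℤ) (c : ℝ) : Γ.Point → EReal
  | Point.vertex _ => 0
  | Point.inner _ t _ _ => (((m : ℝ) * t.toReal + c : ℝ) : EReal)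

theorem affine_param {m : ℤ} {c : ℝ} {e : Γ.E} {t : ℝ≥0} (h0 : 0 < t) (h1 : (t : ℝ≥0∞) < Γ.len e) :
    affine m c (param e t) = (((m : ℝ) * t + c : ℝ) : EReal) := by
  rw [param_inner (by exact_mod_cast h0) h1]
  rfl

theorem isPiecewiseAffineOn_affine (m : ℤ) (c : ℝ) (e : Γ.E) :
    IsPiecewiseAffineOn (affine m c) e :=
  ⟨{0}, fun _ _ hI => ⟨m, c, fun t ht =>
    affine_param (pos_iff_ne_zero.2 fun h0 => (hI t ht).2 (by simp [h0])) (hI t ht).1⟩⟩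

/-- The factor `2` keeps the initial and final segments of length below `ε` of one edge disjoint,
which matters for loops. A common `ε` exists because there are finitely many edges. -/
theorem exists_le_len (Γ : TropicalCurve.{u, v}) : ∃ ε : ℝ≥0, 0 < ε ∧ ∀ e, 2 * (ε : ℝ≥0∞) ≤ Γ.len e := by
  have h : ∀ᶠ ε : ℝ≥0 in 𝓝[>] 0, ∀ e, 2 * (ε : ℝ≥0∞) ≤ Γ.len e := by
    rw [eventually_all]
    intro e
    have hc : Tendsto (fun ε : ℝ≥0 => 2 * (ε : ℝ≥0∞)) (𝓝[>] 0) (𝓝 0) := by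
      have : Continuous (fun ε : ℝ≥0 => 2 * (ε : ℝ≥0∞)) :=
        (ENNReal.continuous_const_mul (by simp)).comp ENNReal.continuous_coe
      simpa using (this.tendsto 0).mono_left nhdsWithin_le_nhds
    exact (hc.eventually (gt_mem_nhds (Γ.len_pos e))).mono fun _ h => h.le
  obtain ⟨ε, h1, h2⟩ := (h.and self_mem_nhdsWithin).exists
  exact ⟨ε, h2, h1⟩

theorem min_le_min_add {a b b' c : ℝ≥0∞} (h : b ≤ b' + c) : min a b ≤ min a b' + c := by
  rw [← min_add_add_right]
  exact min_le_min le_self_add h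

theorem ite_le_ite_add {p : Prop} [Decidable p] {a b c : ℝ≥0∞} (h : a ≤ b + c) :
    (if p then a else ⊤) ≤ (if p then b else ⊤) + c := by
  split_ifs
  · exact h
  · simp

theorem sub_le_sub_add (l s t : ℝ≥0∞) : l - s ≤ l - t + ((s - t) + (t - s)) :=
  tsub_le_tsub_add_tsub.trans (by gcongr; exact le_add_self)

theorem le_add_sub (s t : ℝ≥0∞) : s ≤ t + ((s - t) + (t - s)) := by
  rw [← add_assoc]
  exact le_add_tsub.trans le_self_add

theorem continuous_absDiff {t₀ : ℝ≥0∞} (h : t₀ ≠ ⊤) :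
    Continuous (fun t : ℝ≥0∞ => (t - t₀) + (t₀ - t)) :=
  (ENNReal.continuous_sub_right t₀).add (ENNReal.continuous_sub_left h)

end TropicalCurve

/-! ### Local slopes of rational functions -/

namespace RatFun

open TropicalCurve

variable {Γ : TropicalCurve.{u, v}}

theorem continuousOn_param (f : RatFun Γ) (e : Γ.E) :
    ContinuousOn (fun s => f (param e s)) (Icc 0 (Γ.len e)) :=
  continuousOn_iff_continuous_domRestrict.2 (continuous_iff_edgewise.1 f.cont e)

theorem compl_mem_nhdsGT (B : Finset ℝ≥0) (t : ℝ≥0) : {s | s ∉ B} ∈ 𝓝[>] t := by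
  have : IsClosed ((B : Set ℝ≥0) \ {t}) := (B.finite_toSet.subset sdiff_subset).isClosed
  filter_upwards [mem_nhdsWithin_of_mem_nhds (this.isOpen_compl.mem_nhds (x := t) (by simp)),
    self_mem_nhdsWithin] with s hs hst hsB
  exact hs ⟨hsB, hst.ne'⟩

theorem compl_mem_nhdsLT (B : Finset ℝ≥0) (t : ℝ≥0) : {s | s ∉ B} ∈ 𝓝[<] t := by
  have : IsClosed ((B : Set ℝ≥0) \ {t}) := (B.finite_toSet.subset sdiff_subset).isClosed
  filter_upwards [mem_nhdsWithin_of_mem_nhds (this.isOpen_compl.mem_nhds (x := t) (by simp)),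
    self_mem_nhdsWithin] with s hs hst hsB
  exact hs ⟨hsB, hst.ne⟩

theorem exists_isSlopeFwd {f : RatFun Γ} {e : Γ.E} (hf : IsPiecewiseAffineOn f e) {t : ℝ≥0}
    (ht : (t : ℝ≥0∞) < Γ.len e) : ∃ m, IsSlopeFwd f e t m := by
  obtain ⟨B, hB⟩ := hf
  have hlt : {s : ℝ≥0 | (s : ℝ≥0∞) < Γ.len e} ∈ 𝓝[>] t :=
    mem_nhdsWithin_of_mem_nhds ((isOpen_Iio.preimage ENNReal.continuous_coe).mem_nhds ht)
  obtain ⟨w, hw, hsub⟩ := (mem_nhdsGT_iff_exists_Ioo_subset' (show t < t + 1 by simp)).1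
    (inter_mem (compl_mem_nhdsGT B t) hlt)
  obtain ⟨m, c, h⟩ := hB (Ioo t w) ordConnected_Ioo (fun s hs => ⟨(hsub hs).2, (hsub hs).1⟩)
  refine ⟨m, c, ?_⟩
  filter_upwards [Ioo_mem_nhdsGT (show (t : ℝ≥0∞) < w by exact_mod_cast hw)] with s hs
  lift s to ℝ≥0 using (hs.2.trans ENNReal.coe_lt_top).ne
  exact h s (by simpa using hs)

theorem exists_isSlopeBwd {f : RatFun Γ} {e : Γ.E} (hf : IsPiecewiseAffineOn f e) {t : ℝ≥0∞}
    (h0 : 0 < t) (ht : t ≤ Γ.len e) : ∃ m, IsSlopeBwd f e t m := by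
  induction t with
  | top =>
    obtain ⟨m, c, h⟩ := hf.eventually (top_le_iff.1 ht)
    exact ⟨-m, c, by simpa using h⟩
  | coe t =>
    have h0 : 0 < t := by exact_mod_cast h0
    obtain ⟨B, hB⟩ := hf
    obtain ⟨w, hw, hsub⟩ := (mem_nhdsLT_iff_exists_Ioo_subset' h0).1 (compl_mem_nhdsLT B t)
    obtain ⟨m, c, h⟩ := hB (Ioo w t) ordConnected_Ioo
      (fun s hs => ⟨(ENNReal.coe_lt_coe.2 hs.2).trans_le ht, hsub hs⟩)
    refine ⟨-m, c, ?_⟩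
    filter_upwards [Ioo_mem_nhdsLT (show (w : ℝ≥0∞) < t by exact_mod_cast hw)] with s hs
    lift s to ℝ≥0 using (hs.2.trans ENNReal.coe_lt_top).ne
    simpa using h s (by simpa using hs)

theorem tendsto_affine_coe (m c : ℝ) (t : ℝ≥0) :
    Tendsto (fun s : ℝ≥0∞ => ((m * s.toReal + c : ℝ) : EReal)) (𝓝 t)
      (𝓝 ((m * t + c : ℝ) : EReal)) := by
  refine (continuous_coe_real_ereal.tendsto _).comp ?_
  exact ((ENNReal.tendsto_toReal (ENNReal.coe_ne_top)).const_mul m).add_const c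

/-- The germ gives an affine formula on an open interval to the right of `t`. Continuity of `f` at
`t` identifies its constant term, so increments can be measured from `f (param e t)` itself. -/
theorem IsSlopeFwd.apply_add {f : RatFun Γ} {e : Γ.E} {t : ℝ≥0} {m : ℤ} (h : IsSlopeFwd f e t m)
    (ht : (t : ℝ≥0∞) < Γ.len e) :
    ∃ η : ℝ≥0, 0 < η ∧ ∀ δ : ℝ≥0, δ < η →
      f (param e ((t : ℝ≥0∞) + δ)) = f (param e t) + (((m : ℝ) * δ : ℝ) : EReal) := by
  obtain ⟨c, hc⟩ := h
  have hle : 𝓝[>] (t : ℝ≥0∞) ≤ 𝓝[Icc 0 (Γ.len e)] (t : ℝ≥0∞) :=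
    nhdsWithin_le_of_mem (mem_of_superset (Ioo_mem_nhdsGT ht) fun s hs => ⟨zero_le, hs.2.le⟩)
  have h1 : Tendsto (fun s => f (param e s)) (𝓝[>] (t : ℝ≥0∞)) (𝓝 (f (param e t))) :=
    (f.continuousOn_param e _ ⟨zero_le, ht.le⟩).mono_left hle
  have : (𝓝[>] (t : ℝ≥0∞)).NeBot := nhdsGT_neBot_of_exists_gt ⟨_, ht⟩
  have h2 := tendsto_nhds_unique h1
    (((tendsto_affine_coe m c t).mono_left nhdsWithin_le_nhds).congr' (hc.mono fun _ h => h.symm))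
  obtain ⟨w, hw, hsub⟩ := (mem_nhdsGT_iff_exists_Ioo_subset' ht).1 hc
  have hw' : 0 < w - t := tsub_pos_of_lt hw
  obtain ⟨η, hη, hηw⟩ := ENNReal.lt_iff_exists_nnreal_btwn.1 hw'
  refine ⟨η, by exact_mod_cast hη, fun δ hδ => ?_⟩
  rcases eq_or_ne δ 0 with rfl | h0
  · simp
  have hmem : (t : ℝ≥0∞) + δ ∈ Ioo (t : ℝ≥0∞) w := by
    refine ⟨ENNReal.lt_add_right ENNReal.coe_ne_top (by exact_mod_cast h0), ?_⟩
    rw [add_comm]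
    exact lt_tsub_iff_right.1 ((ENNReal.coe_lt_coe.2 hδ).trans hηw)
  rw [hsub hmem, h2, ← EReal.coe_add, ← ENNReal.coe_add, ENNReal.coe_toReal]
  congr 1
  push_cast
  ring

theorem IsSlopeBwd.apply_sub {f : RatFun Γ} {e : Γ.E} {t : ℝ≥0} {m : ℤ} (h : IsSlopeBwd f e t m)
    (h0 : 0 < t) (ht : (t : ℝ≥0∞) ≤ Γ.len e) :
    ∃ η : ℝ≥0, 0 < η ∧ ∀ δ : ℝ≥0, δ < η →
      f (param e ((t : ℝ≥0∞) - δ)) = f (param e t) + (((m : ℝ) * δ : ℝ) : EReal) := by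
  obtain ⟨c, hc⟩ := h
  have h0' : (0 : ℝ≥0∞) < t := by exact_mod_cast h0
  have hle : 𝓝[<] (t : ℝ≥0∞) ≤ 𝓝[Icc 0 (Γ.len e)] (t : ℝ≥0∞) :=
    nhdsWithin_le_of_mem
      (mem_of_superset (Ioo_mem_nhdsLT h0') fun s hs => ⟨zero_le, hs.2.le.trans ht⟩)
  have h1 : Tendsto (fun s => f (param e s)) (𝓝[<] (t : ℝ≥0∞)) (𝓝 (f (param e t))) :=
    (f.continuousOn_param e _ ⟨zero_le, ht⟩).mono_left hle
  have : (𝓝[<] (t : ℝ≥0∞)).NeBot := nhdsLT_neBot_of_exists_lt ⟨_, h0'⟩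
  have h2 := tendsto_nhds_unique h1
    (((tendsto_affine_coe (-m) c t).mono_left nhdsWithin_le_nhds).congr'
      (hc.mono fun _ h => h.symm))
  obtain ⟨w, hw, hsub⟩ := (mem_nhdsLT_iff_exists_Ioo_subset' h0').1 hc
  have hw : w < t := hw
  lift w to ℝ≥0 using (hw.trans ENNReal.coe_lt_top).ne
  have hw : w < t := by exact_mod_cast hw
  refine ⟨t - w, tsub_pos_of_lt hw, fun δ hδ => ?_⟩
  rcases eq_or_ne δ 0 with rfl | hδ0
  · simp
  have hδt : δ ≤ t := hδ.le.trans tsub_le_self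
  have hmem : ((t - δ : ℝ≥0) : ℝ≥0∞) ∈ Ioo (w : ℝ≥0∞) t := by
    refine ⟨ENNReal.coe_lt_coe.2 ?_, ENNReal.coe_lt_coe.2 ?_⟩
    · exact lt_tsub_comm.1 hδ
    · exact tsub_lt_self h0 (pos_iff_ne_zero.2 hδ0)
  rw [← ENNReal.coe_sub, hsub hmem, h2, ← EReal.coe_add, ENNReal.coe_toReal, NNReal.coe_sub hδt]
  congr 1
  ring

theorem eq_zero_iff {f : RatFun Γ} : f = 0 ↔ ∀ x, f x = ⊥ :=
  ⟨fun h x => by rw [h]; rfl, fun h => RatFun.ext h⟩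

theorem rational_of_ne_zero {f : RatFun Γ} (hf : f ≠ 0) :
    (∀ x ∈ Γ.finite, f x ≠ ⊥ ∧ f x ≠ ⊤) ∧ ∀ e, IsPiecewiseAffineOn f e :=
  f.rational.resolve_left fun h => hf (eq_zero_iff.2 h)

theorem isSlopeFwd_slopeFwd {f : RatFun Γ} (hf : f ≠ 0) {e : Γ.E} {t : ℝ≥0}
    (ht : (t : ℝ≥0∞) < Γ.len e) : IsSlopeFwd f e t (slopeFwd f e t) := by
  have h := exists_isSlopeFwd ((rational_of_ne_zero hf).2 e) ht
  rw [slopeFwd, dif_pos h]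
  exact h.choose_spec

theorem isSlopeBwd_slopeBwd {f : RatFun Γ} (hf : f ≠ 0) {e : Γ.E} {t : ℝ≥0∞} (h0 : 0 < t)
    (ht : t ≤ Γ.len e) : IsSlopeBwd f e t (slopeBwd f e t) := by
  have h := exists_isSlopeBwd ((rational_of_ne_zero hf).2 e) h0 ht
  rw [slopeBwd, dif_pos h]
  exact h.choose_spec

end RatFun

/-! ### Small balls around vertices -/

namespace TropicalCurve

variable {Γ : TropicalCurve.{u, v}}

/-- The structure of a small ball around a finite point `x`: it is the union of the segments
`γ i`, `i : ι`, which start at `x` and are parametrized by the distance to `x`. The function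
`rad` is the distance to `x`, truncated at `ε`. -/
structure Star (x : Γ.Point) where
  ι : Type v
  [fintype : Fintype ι]
  γ : ι → ℝ≥0 → Γ.Point
  ε : ℝ≥0
  pos : 0 < ε
  rad : Γ.Point → ℝ≥0∞
  rad_le : ∀ z, rad z ≤ ε
  rad_le_pdist : ∀ z, rad z ≤ pdist x z
  pdist_le : ∀ i δ, δ < ε → pdist x (γ i δ) ≤ δ
  rad_γ : ∀ i δ, δ < ε → rad (γ i δ) = δ
  eq_of_rad_eq_zero : ∀ z, rad z = 0 → z = x
  exists_of_rad_eq : ∀ z (δ : ℝ≥0), 0 < δ → δ < ε → rad z = δ → ∃ i, z = γ i δ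
  injective : ∀ δ : ℝ≥0, 0 < δ → δ < ε → Function.Injective (fun i => γ i δ)
  fn : RatFun Γ
  fn_apply : ∀ z, fn z = -(rad z : EReal)
  slopes : ∀ f : RatFun Γ, f ≠ 0 → ∃ m : ι → ℤ, RatFun.slopeSum f x = ∑ i, m i ∧
    ∃ η : ℝ≥0, 0 < η ∧ ∀ i (δ : ℝ≥0), δ < η → f (γ i δ) = f x + (((m i : ℝ) * δ : ℝ) : EReal)

attribute [instance] Star.fintype

theorem coe_coe_ereal (t : ℝ≥0) : ((t : ℝ≥0∞) : EReal) = ((t : ℝ) : EReal) := rfl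

theorem neg_coe_min (a b : ℝ≥0∞) :
    -((min a b : ℝ≥0∞) : EReal) = max (-(a : EReal)) (-(b : EReal)) := by
  have hm : Antitone (fun x : ℝ≥0∞ => -(x : EReal)) := fun x y h => by simpa using h
  exact hm.map_min

open Classical in
/-- The distance to the vertex `a`, truncated at a small number `ε`. -/
noncomputable def vertexRad (a : Γ.V) (ε : ℝ≥0) : Γ.Point → ℝ≥0∞
  | Point.vertex b => if b = a then 0 else ε
  | Point.inner e t _ _ =>
      min ε (min (if Γ.src e = a then t else ⊤) (if Γ.tgt e = a then Γ.len e - t else ⊤))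

theorem le_sub_of_two_mul_le {ε l : ℝ≥0∞} (h : 2 * ε ≤ l) (hε : ε ≠ ⊤) : ε ≤ l - ε :=
  ENNReal.le_sub_of_add_le_right hε (by rwa [← two_mul])

theorem le_of_two_mul_le {ε l : ℝ≥0∞} (h : 2 * ε ≤ l) : ε ≤ l :=
  le_trans (by rw [two_mul]; exact le_self_add) h

open Classical in
-- At an endpoint other than `a` the cutoff `ε` must win against the distance measured from the
-- opposite end, which is the whole length; this is where `ε ≤ len e` enters.
theorem vertexRad_param (a : Γ.V) {ε : ℝ≥0} {e : Γ.E} (hε : 2 * (ε : ℝ≥0∞) ≤ Γ.len e) {t : ℝ≥0∞}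
    (ht : t ≤ Γ.len e) : vertexRad a ε (param e t) =
      min (ε : ℝ≥0∞)
        (min (if Γ.src e = a then t else ⊤) (if Γ.tgt e = a then Γ.len e - t else ⊤)) := by
  have hle := le_of_two_mul_le hε
  rcases eq_or_ne t 0 with rfl | h0
  · rw [param_zero, vertexRad]
    split_ifs <;> simp [hle]
  rcases ht.lt_or_eq with h1 | rfl
  · rw [param_inner (pos_iff_ne_zero.2 h0) h1, vertexRad]
  · rw [param_len, vertexRad]
    split_ifs <;> simp [hle]

/-- The part of a star at a vertex: the edges starting there, and the edges ending there. -/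
noncomputable def vertexGerm (a : Γ.V) :
    {e // Γ.src e = a} ⊕ {e // Γ.tgt e = a} → ℝ≥0 → Γ.Point
  | Sum.inl e, δ => param e.1 δ
  | Sum.inr e, δ => param e.1 (Γ.len e - δ)

theorem len_ne_top_of_tgt {a : Γ.V} (ha : Point.vertex a ∈ Γ.finite) {e : Γ.E}
    (he : Γ.tgt e = a) : Γ.len e ≠ ⊤ := fun h => ha ⟨e, h, by rw [he]⟩

theorem continuous_vertexRad {a : Γ.V} (ha : Point.vertex a ∈ Γ.finite) {ε : ℝ≥0}
    (hε : ∀ e, 2 * (ε : ℝ≥0∞) ≤ Γ.len e) : Continuous (vertexRad a ε) := by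
  classical
  rw [continuous_iff_edgewise]
  intro e
  have h : (fun t : Icc (0 : ℝ≥0∞) (Γ.len e) => vertexRad a ε (param e t)) = fun t =>
      min (ε : ℝ≥0∞)
        (min (if Γ.src e = a then t.1 else ⊤) (if Γ.tgt e = a then Γ.len e - t.1 else ⊤)) :=
    funext fun t => vertexRad_param a (hε e) t.2.2
  rw [h]
  refine continuous_const.min (Continuous.min ?_ ?_)
  · split_ifs
    · exact continuous_subtype_val
    · exact continuous_const
  · split_ifs with h1
    · exact (ENNReal.continuous_sub_left (len_ne_top_of_tgt ha h1)).comp continuous_subtype_val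
    · exact continuous_const

theorem vertexRad_le (a : Γ.V) (ε : ℝ≥0) (z : Γ.Point) : vertexRad a ε z ≤ ε := by
  cases z with
  | vertex b => rw [vertexRad]; split_ifs <;> simp
  | inner e t h0 h1 => exact min_le_left _ _

/-- With `y` the vertex `a`, where `vertexRad` vanishes, this bounds the path metric from below by
an explicit function. -/
theorem vertexRad_le_add (a : Γ.V) {ε : ℝ≥0} (hε : ∀ e, 2 * (ε : ℝ≥0∞) ≤ Γ.len e)
    (x y : Γ.Point) : vertexRad a ε x ≤ vertexRad a ε y + pdist x y := by
  classical
  refine le_add_pdist (fun e s t hs ht => ?_) x y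
  rw [vertexRad_param a (hε e) hs, vertexRad_param a (hε e) ht]
  refine min_le_min_add ((min_le_min (ite_le_ite_add (le_add_sub s t))
    (ite_le_ite_add (sub_le_sub_add _ s t))).trans ?_)
  rw [min_add_add_right]

theorem isPiecewiseAffineOn_neg_vertexRad {a : Γ.V} (ha : Point.vertex a ∈ Γ.finite) {ε : ℝ≥0}
    (hε : ∀ e, 2 * (ε : ℝ≥0∞) ≤ Γ.len e) (e : Γ.E) :
    IsPiecewiseAffineOn (fun z => -(vertexRad a ε z : EReal)) e := by
  classical
  -- The cutoff at `ε` is one more maximum with a constant, so only the distance within the edge is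
  -- left to treat, according to which of its ends are `a`.
  have key : ∀ f : Γ.Point → EReal, IsPiecewiseAffineOn f e → (∀ t : ℝ≥0, 0 < t →
      (t : ℝ≥0∞) < Γ.len e → f (param e t) =
      -((min (if Γ.src e = a then (t : ℝ≥0∞) else ⊤)
        (if Γ.tgt e = a then Γ.len e - t else ⊤) : ℝ≥0∞) : EReal)) →
      IsPiecewiseAffineOn (fun z => -(vertexRad a ε z : EReal)) e := by
    intro f hf H
    refine IsPiecewiseAffineOn.congr_inner
      ((isPiecewiseAffineOn_affine 0 (-(ε : ℝ)) e).sup hf) fun t h0 h1 => ?_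
    rw [H t h0 h1, affine_param h0 h1, vertexRad_param a (hε e) h1.le]
    rw [neg_coe_min]
    simp [coe_coe_ereal]
  by_cases h1 : Γ.src e = a <;> by_cases h2 : Γ.tgt e = a
  · obtain ⟨l, hl⟩ := WithTop.ne_top_iff_exists.1 (len_ne_top_of_tgt ha h2)
    replace hl : (l : ℝ≥0∞) = Γ.len e := hl
    refine key _ ((isPiecewiseAffineOn_affine (-1) 0 e).sup
      (isPiecewiseAffineOn_affine 1 (-(l : ℝ)) e)) fun t h0 h => ?_
    rw [if_pos h1, if_pos h2, neg_coe_min, affine_param h0 h, affine_param h0 h]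
    rw [← hl] at h ⊢
    have hle : t ≤ l := by exact_mod_cast h.le
    rw [← ENNReal.coe_sub]
    rw [coe_coe_ereal, coe_coe_ereal, ← EReal.coe_neg, ← EReal.coe_neg, NNReal.coe_sub hle]
    congr 2
    · simp
    · push_cast; ring
  · refine key _ (isPiecewiseAffineOn_affine (-1) 0 e) fun t h0 h => ?_
    rw [if_pos h1, if_neg h2, affine_param h0 h]
    simp [coe_coe_ereal]
  · obtain ⟨l, hl⟩ := WithTop.ne_top_iff_exists.1 (len_ne_top_of_tgt ha h2)
    replace hl : (l : ℝ≥0∞) = Γ.len e := hl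
    refine key _ (isPiecewiseAffineOn_affine 1 (-(l : ℝ)) e) fun t h0 h => ?_
    rw [if_neg h1, if_pos h2, affine_param h0 h]
    rw [← hl] at h ⊢
    have hle : t ≤ l := by exact_mod_cast h.le
    rw [← ENNReal.coe_sub]
    rw [min_top_left, coe_coe_ereal, ← EReal.coe_neg, NNReal.coe_sub hle]
    congr 1
    push_cast
    ring
  · refine IsPiecewiseAffineOn.congr_inner (isPiecewiseAffineOn_affine 0 (-(ε : ℝ)) e)
      fun t h0 h => ?_
    rw [affine_param h0 h, vertexRad_param a (hε e) h.le, if_neg h1, if_neg h2]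
    simp [coe_coe_ereal]

theorem coe_ereal_continuous_neg {σ : Γ.Point → ℝ≥0∞} (h : Continuous σ) :
    Continuous (fun z => -(σ z : EReal)) :=
  continuous_neg.comp (continuous_coe_ennreal_ereal.comp h)

theorem neg_coe_ne {a : ℝ≥0∞} {ε : ℝ≥0} (h : a ≤ ε) : -(a : EReal) ≠ ⊥ ∧ -(a : EReal) ≠ ⊤ := by
  lift a to ℝ≥0 using ne_top_of_le_ne_top ENNReal.coe_ne_top h
  rw [coe_coe_ereal, ← EReal.coe_neg]
  exact ⟨EReal.coe_ne_bot _, EReal.coe_ne_top _⟩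

theorem nonempty_star_vertex {a : Γ.V} (ha : Point.vertex a ∈ Γ.finite) :
    Nonempty (Star (Point.vertex a : Γ.Point)) := by
  classical
  obtain ⟨ε, hε0, hε⟩ := exists_le_len Γ
  have hle : ∀ (e : Γ.E) (δ : ℝ≥0), δ < ε → (δ : ℝ≥0∞) ≤ Γ.len e := fun e δ h =>
    (ENNReal.coe_le_coe.2 h.le).trans (le_of_two_mul_le (hε e))
  -- Strictness separates the two germs of a loop: at equal radius they have the different
  -- parameters `δ` and `len e - δ`.
  have hle' : ∀ (e : Γ.E) (δ : ℝ≥0), δ < ε → (δ : ℝ≥0∞) < Γ.len e - δ := fun e δ h => by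
    refine (ENNReal.coe_lt_coe.2 h).trans_le
      ((le_sub_of_two_mul_le (hε e) ENNReal.coe_ne_top).trans (tsub_le_tsub_left ?_ _))
    exact_mod_cast h.le
  have hrad0 : vertexRad a ε (Point.vertex a) = 0 := by simp [vertexRad]
  refine ⟨{
    ι := {e // Γ.src e = a} ⊕ {e // Γ.tgt e = a}
    γ := vertexGerm a
    ε := ε
    pos := hε0
    rad := vertexRad a ε
    rad_le := vertexRad_le a ε
    rad_le_pdist := fun z => ?_
    pdist_le := ?_
    rad_γ := ?_
    eq_of_rad_eq_zero := ?_
    exists_of_rad_eq := ?_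
    injective := ?_
    fn := ⟨fun z => -(vertexRad a ε z : EReal),
      coe_ereal_continuous_neg (continuous_vertexRad ha hε), Or.inr
        ⟨fun z _ => neg_coe_ne (vertexRad_le a ε z), isPiecewiseAffineOn_neg_vertexRad ha hε⟩⟩
    fn_apply := fun _ => rfl
    slopes := ?_ }⟩
  · have := vertexRad_le_add a hε z (Point.vertex a)
    rwa [hrad0, zero_add, pdist_comm] at this
  · rintro (⟨e, rfl⟩ | ⟨e, rfl⟩) δ hδ
    · rw [← param_zero]
      refine (pdist_param_le zero_le (hle e δ hδ)).trans (by simp)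
    · rw [← param_len]
      refine (pdist_param_le le_rfl tsub_le_self).trans ?_
      rw [tsub_eq_zero_of_le (tsub_le_self : Γ.len e - δ ≤ Γ.len e), add_zero]
      exact tsub_tsub_le
  · rintro (⟨e, he⟩ | ⟨e, he⟩) δ hδ
    · rw [vertexGerm, vertexRad_param a (hε e) (hle e δ hδ), if_pos he]
      have h1 : (δ : ℝ≥0∞) ≤ if Γ.tgt e = a then Γ.len e - δ else ⊤ := by
        split_ifs
        · exact (hle' e δ hδ).le
        · exact le_top
      rw [min_eq_left h1, min_eq_right (by exact_mod_cast hδ.le)]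
    · rw [vertexGerm, vertexRad_param a (hε e) tsub_le_self, if_pos he]
      have h1 : (δ : ℝ≥0∞) ≤ if Γ.src e = a then Γ.len e - δ else ⊤ := by
        split_ifs
        · exact (hle' e δ hδ).le
        · exact le_top
      rw [ENNReal.sub_sub_cancel (len_ne_top_of_tgt ha he) (hle e δ hδ), min_eq_right h1,
        min_eq_right (by exact_mod_cast hδ.le)]
  · rintro (b | ⟨e, t, h0, h1⟩) h
    · rw [vertexRad] at h
      split_ifs at h with hb
      · rw [hb]
      · exact absurd h (by exact_mod_cast hε0.ne')
    · exfalso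
      rw [vertexRad, ← bot_eq_zero, min_eq_bot, min_eq_bot] at h
      rcases h with h | h | h
      · exact absurd h (by simpa using hε0.ne')
      · split_ifs at h
        · exact h0.ne' h
        · exact absurd h (by simp)
      · split_ifs at h
        · exact absurd h (tsub_pos_of_lt h1).ne'
        · exact absurd h (by simp)
  · rintro (b | ⟨e, t, h0, h1⟩) δ hδ0 hδ h
    · rw [vertexRad] at h
      split_ifs at h with hb
      · exact absurd h.symm (by exact_mod_cast hδ0.ne')
      · exact absurd h.symm (by exact_mod_cast hδ.ne)
    · rw [vertexRad] at h
      have h' : (if Γ.src e = a then t else ⊤) = δ ∨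
          (if Γ.tgt e = a then Γ.len e - t else ⊤) = δ := by
        rcases min_choice (ε : ℝ≥0∞) (min (if Γ.src e = a then t else ⊤)
          (if Γ.tgt e = a then Γ.len e - t else ⊤)) with h2 | h2
        · rw [h2] at h
          exact absurd h.symm (by exact_mod_cast hδ.ne)
        · rw [h2] at h
          rcases min_choice (if Γ.src e = a then t else ⊤)
            (if Γ.tgt e = a then Γ.len e - t else ⊤) with h3 | h3 <;> rw [h3] at h
          · exact Or.inl h
          · exact Or.inr h
      rcases h' with h | h
      · split_ifs at h with hs
        · exact ⟨Sum.inl ⟨e, hs⟩, by rw [vertexGerm, ← h, param_inner h0 h1]⟩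
        · exact absurd h.symm ENNReal.coe_ne_top
      · split_ifs at h with hs
        · refine ⟨Sum.inr ⟨e, hs⟩, ?_⟩
          rw [vertexGerm, ← h, ENNReal.sub_sub_cancel (len_ne_top_of_tgt ha hs) h1.le,
            param_inner h0 h1]
        · exact absurd h.symm ENNReal.coe_ne_top
  · intro δ hδ0 hδ
    have hlt : ∀ e, (δ : ℝ≥0∞) < Γ.len e := fun e =>
      (hle' e δ hδ).trans_le tsub_le_self
    have hp : (0 : ℝ≥0∞) < δ := by exact_mod_cast hδ0
    have hlt' : ∀ e, Γ.tgt e = a → Γ.len e - δ < Γ.len e := fun e he =>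
      ENNReal.sub_lt_self (len_ne_top_of_tgt ha he) (Γ.len_pos e).ne' hp.ne'
    have hp' : ∀ e, 0 < Γ.len e - δ := fun e => hp.trans (hle' e δ hδ)
    rintro (⟨e, he⟩ | ⟨e, he⟩) (⟨e', he'⟩ | ⟨e', he'⟩) h <;> simp only [vertexGerm] at h
    · rw [param_inner hp (hlt e), param_inner hp (hlt e')] at h
      injection h with h1 h2
      subst h1
      rfl
    · rw [param_inner hp (hlt e), param_inner (hp' e') (hlt' e' he')] at h
      injection h with h1 h2
      exact absurd h2 (hle' e' δ hδ).ne
    · rw [param_inner hp (hlt e'), param_inner (hp' e) (hlt' e he)] at h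
      injection h with h1 h2
      exact absurd h2 (hle' e δ hδ).ne'
    · rw [param_inner (hp' e) (hlt' e he), param_inner (hp' e') (hlt' e' he')] at h
      injection h with h1 h2
      subst h1
      rfl
  · intro f hf
    refine ⟨Sum.elim (fun e => RatFun.slopeFwd f e.1 0)
      (fun e => RatFun.slopeBwd f e.1 (Γ.len e.1)), ?_, ?_⟩
    · rw [Fintype.sum_sum_type, RatFun.slopeSum]
      simp only [Sum.elim_inl, Sum.elim_inr]
      congr 1
      · exact Finset.sum_subtype _ (by simp) _
      · exact Finset.sum_subtype _ (by simp) _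
    -- Each germ has its own range of validity; phrasing it as an eventual statement lets the
    -- finitely many germs share one `η`.
    · have key : ∀ i : {e // Γ.src e = a} ⊕ {e // Γ.tgt e = a}, ∀ᶠ η : ℝ≥0 in 𝓝[>] 0,
          ∀ δ : ℝ≥0, δ < η → f (vertexGerm a i δ) = f (Point.vertex a) +
            ((((Sum.elim (fun e => RatFun.slopeFwd f e.1 0)
              (fun e => RatFun.slopeBwd f e.1 (Γ.len e.1)) i : ℤ) : ℝ) * δ : ℝ) : EReal) := by
        have aux : ∀ P : ℝ≥0 → Prop, (∃ η : ℝ≥0, 0 < η ∧ ∀ δ, δ < η → P δ) →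
            ∀ᶠ η : ℝ≥0 in 𝓝[>] 0, ∀ δ : ℝ≥0, δ < η → P δ := by
          rintro P ⟨η, hη, h⟩
          filter_upwards [Ioo_mem_nhdsGT hη] with η' hη' δ hδ
          exact h δ (hδ.trans hη'.2)
        rintro (⟨e, rfl⟩ | ⟨e, he⟩)
        · refine aux _ ?_
          obtain ⟨η, hη, h⟩ := (RatFun.isSlopeFwd_slopeFwd hf (e := e) (t := 0)
            (by simpa using Γ.len_pos e)).apply_add (by simpa using Γ.len_pos e)
          refine ⟨η, hη, fun δ hδ => ?_⟩
          simpa [vertexGerm, param_zero] using h δ hδ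
        · refine aux _ ?_
          obtain ⟨l, hl⟩ := WithTop.ne_top_iff_exists.1 (len_ne_top_of_tgt ha he)
          replace hl : (l : ℝ≥0∞) = Γ.len e := hl
          have hs := RatFun.isSlopeBwd_slopeBwd hf (Γ.len_pos e) le_rfl
          rw [← hl] at hs
          obtain ⟨η, hη, h⟩ := hs.apply_sub
            (by have := Γ.len_pos e; rw [← hl] at this; exact_mod_cast this) hl.le
          refine ⟨η, hη, fun δ hδ => ?_⟩
          have := h δ hδ
          rw [hl, param_len, he] at this
          exact this
      obtain ⟨η, h1, h2⟩ := ((eventually_all.2 key).and self_mem_nhdsWithin).exists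
      exact ⟨η, h2, h1⟩

end TropicalCurve
-- Small balls around interior points of edges
namespace TropicalCurve

variable {Γ : TropicalCurve.{u, v}}

open Classical in
/-- The distance to the inner point of `e₀` with parameter `t₀`, truncated at a small `ε`. -/
noncomputable def innerRad (e₀ : Γ.E) (t₀ ε : ℝ≥0) : Γ.Point → ℝ≥0∞
  | Point.vertex _ => ε
  | Point.inner e t _ _ => if e = e₀ then min ε ((t - t₀) + (t₀ - t)) else ε

open Classical in
theorem innerRad_param {e₀ : Γ.E} {t₀ ε : ℝ≥0} (hl : ε ≤ t₀) (hr : (t₀ : ℝ≥0∞) + ε ≤ Γ.len e₀)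
    {e : Γ.E} {t : ℝ≥0∞} (ht : t ≤ Γ.len e) :
    innerRad e₀ t₀ ε (param e t) = if e = e₀ then min (ε : ℝ≥0∞) ((t - t₀) + (t₀ - t)) else ε := by
  rcases eq_or_ne t 0 with rfl | h0
  · rw [param_zero, innerRad]
    split_ifs with h
    · rw [min_eq_left]
      simpa using hl
    · rfl
  rcases ht.lt_or_eq with h1 | rfl
  · rw [param_inner (pos_iff_ne_zero.2 h0) h1, innerRad]
  · rw [param_len, innerRad]
    split_ifs with h
    · subst h
      rw [min_eq_left]
      exact (ENNReal.le_sub_of_add_le_left ENNReal.coe_ne_top hr).trans le_self_add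
    · rfl

theorem innerRad_le (e₀ : Γ.E) (t₀ ε : ℝ≥0) (z : Γ.Point) : innerRad e₀ t₀ ε z ≤ ε := by
  cases z with
  | vertex b => exact le_rfl
  | inner e t h0 h1 => rw [innerRad]; split_ifs <;> simp

theorem absDiff_le (s t w : ℝ≥0∞) :
    (s - w) + (w - s) ≤ (t - w) + (w - t) + ((s - t) + (t - s)) := by
  have h1 : s - w ≤ (s - t) + (t - w) := tsub_le_tsub_add_tsub
  have h2 : w - s ≤ (w - t) + (t - s) := tsub_le_tsub_add_tsub
  exact (add_le_add h1 h2).trans (le_of_eq (by ring))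

theorem innerRad_le_add {e₀ : Γ.E} {t₀ ε : ℝ≥0} (hl : ε ≤ t₀)
    (hr : (t₀ : ℝ≥0∞) + ε ≤ Γ.len e₀) (x y : Γ.Point) :
    innerRad e₀ t₀ ε x ≤ innerRad e₀ t₀ ε y + pdist x y := by
  refine le_add_pdist (fun e s t hs ht => ?_) x y
  rw [innerRad_param hl hr hs, innerRad_param hl hr ht]
  split_ifs
  · exact min_le_min_add (absDiff_le s t t₀)
  · exact le_self_add

theorem continuous_innerRad {e₀ : Γ.E} {t₀ ε : ℝ≥0} (hl : ε ≤ t₀)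
    (hr : (t₀ : ℝ≥0∞) + ε ≤ Γ.len e₀) : Continuous (innerRad e₀ t₀ ε) := by
  classical
  rw [continuous_iff_edgewise]
  intro e
  have h : (fun t : Icc (0 : ℝ≥0∞) (Γ.len e) => innerRad e₀ t₀ ε (param e t)) = fun t =>
      if e = e₀ then min (ε : ℝ≥0∞) ((t.1 - t₀) + (t₀ - t.1)) else ε :=
    funext fun t => innerRad_param hl hr t.2.2
  rw [h]
  split_ifs
  · exact continuous_const.min ((continuous_absDiff ENNReal.coe_ne_top).comp continuous_subtype_val)
  · exact continuous_const

theorem coe_absDiff (s t : ℝ≥0) :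
    ((((s : ℝ≥0∞) - t) + (t - s) : ℝ≥0∞) : EReal) = ((|(s : ℝ) - t| : ℝ) : EReal) := by
  rw [← ENNReal.coe_sub, ← ENNReal.coe_sub, ← ENNReal.coe_add, coe_coe_ereal]
  congr 1
  rcases le_total s t with h | h
  · rw [tsub_eq_zero_of_le h, zero_add, NNReal.coe_sub h, abs_of_nonpos, neg_sub]
    exact sub_nonpos.2 (by exact_mod_cast h)
  · rw [tsub_eq_zero_of_le h, add_zero, NNReal.coe_sub h, abs_of_nonneg]
    exact sub_nonneg.2 (by exact_mod_cast h)

theorem isPiecewiseAffineOn_neg_innerRad {e₀ : Γ.E} {t₀ ε : ℝ≥0} (hl : ε ≤ t₀)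
    (hr : (t₀ : ℝ≥0∞) + ε ≤ Γ.len e₀) (e : Γ.E) :
    IsPiecewiseAffineOn (fun z => -(innerRad e₀ t₀ ε z : EReal)) e := by
  classical
  by_cases he : e = e₀
  · refine IsPiecewiseAffineOn.congr_inner ((isPiecewiseAffineOn_affine 0 (-(ε : ℝ)) e).sup
      ((isPiecewiseAffineOn_affine 1 (-(t₀ : ℝ)) e).sup
      (isPiecewiseAffineOn_affine (-1) (t₀ : ℝ) e)).neg) fun t h0 h1 => ?_
    rw [innerRad_param hl hr h1.le, if_pos he, neg_coe_min, affine_param h0 h1, affine_param h0 h1,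
      affine_param h0 h1, coe_absDiff, ← EReal.coe_strictMono.monotone.map_max, coe_coe_ereal, abs_eq_max_neg]
    congr 1
    · simp
    · congr 3
      · push_cast; ring
      · push_cast; ring
  · refine IsPiecewiseAffineOn.congr_inner (isPiecewiseAffineOn_affine 0 (-(ε : ℝ)) e)
      fun t h0 h => ?_
    rw [affine_param h0 h, innerRad_param hl hr h.le, if_neg he]
    simp [coe_coe_ereal]

theorem nonempty_star_inner {e₀ : Γ.E} {t₀ : ℝ≥0} (h0 : 0 < (t₀ : ℝ≥0∞))
    (h1 : (t₀ : ℝ≥0∞) < Γ.len e₀) : Nonempty (Star (Point.inner e₀ t₀ h0 h1)) := by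
  classical
  -- The ball has to stay inside the edge, so `ε` is bounded by the parameter distances from `t₀` to
  -- both ends.
  obtain ⟨ε, hε0, hl, hr⟩ : ∃ ε : ℝ≥0, 0 < ε ∧ ε ≤ t₀ ∧ (t₀ : ℝ≥0∞) + ε ≤ Γ.len e₀ := by
    obtain ⟨η, hη, hηw⟩ := ENNReal.lt_iff_exists_nnreal_btwn.1 (tsub_pos_of_lt h1)
    refine ⟨min η t₀, lt_min (by exact_mod_cast hη) (by exact_mod_cast h0), min_le_right _ _, ?_⟩
    rw [add_comm]
    refine (lt_tsub_iff_right.1 (lt_of_le_of_lt ?_ hηw)).le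
    exact_mod_cast min_le_left η t₀
  have hlδ : ∀ δ : ℝ≥0, δ < ε → (t₀ : ℝ≥0∞) - δ ≤ Γ.len e₀ := fun δ _ => tsub_le_self.trans h1.le
  have hrδ : ∀ δ : ℝ≥0, δ < ε → (t₀ : ℝ≥0∞) + δ < Γ.len e₀ := fun δ h =>
    (ENNReal.add_lt_add_left ENNReal.coe_ne_top (ENNReal.coe_lt_coe.2 h)).trans_le hr
  have hpδ : ∀ δ : ℝ≥0, δ < ε → 0 < (t₀ : ℝ≥0∞) - δ := fun δ h =>
    tsub_pos_of_lt (ENNReal.coe_lt_coe.2 (h.trans_le hl))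
  have hcan : ∀ δ : ℝ≥0, δ < ε → (t₀ : ℝ≥0∞) - (t₀ - δ) = δ := fun δ h =>
    ENNReal.sub_sub_cancel ENNReal.coe_ne_top (by exact_mod_cast h.le.trans hl)
  have hd1 : ∀ δ : ℝ≥0, ((t₀ : ℝ≥0∞) + δ - t₀) + (t₀ - (t₀ + δ)) = δ := fun δ => by
    rw [ENNReal.add_sub_cancel_left ENNReal.coe_ne_top, tsub_eq_zero_of_le le_self_add, add_zero]
  have hd2 : ∀ δ : ℝ≥0, δ < ε → ((t₀ : ℝ≥0∞) - δ - t₀) + (t₀ - (t₀ - δ)) = δ := fun δ h => by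
    rw [hcan δ h, tsub_eq_zero_of_le tsub_le_self, zero_add]
  have hx : Point.inner e₀ t₀ h0 h1 = param e₀ t₀ := (param_inner h0 h1).symm
  have hrad0 : innerRad e₀ t₀ ε (param e₀ t₀) = 0 := by
    rw [innerRad_param hl hr h1.le, if_pos rfl]
    simp
  rw [hx]
  refine ⟨{
    ι := ULift.{v} Bool
    γ := fun b δ => if b.down then param e₀ ((t₀ : ℝ≥0∞) + δ) else param e₀ ((t₀ : ℝ≥0∞) - δ)
    ε := ε
    pos := hε0
    rad := innerRad e₀ t₀ ε
    rad_le := innerRad_le e₀ t₀ ε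
    rad_le_pdist := fun z => ?_
    pdist_le := ?_
    rad_γ := ?_
    eq_of_rad_eq_zero := ?_
    exists_of_rad_eq := ?_
    injective := ?_
    fn := ⟨fun z => -(innerRad e₀ t₀ ε z : EReal),
      coe_ereal_continuous_neg (continuous_innerRad hl hr), Or.inr
        ⟨fun z _ => neg_coe_ne (innerRad_le e₀ t₀ ε z), isPiecewiseAffineOn_neg_innerRad hl hr⟩⟩
    fn_apply := fun _ => rfl
    slopes := ?_ }⟩
  · have := innerRad_le_add hl hr z (param e₀ t₀)
    rwa [hrad0, zero_add, pdist_comm] at this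
  · rintro ⟨_ | _⟩ δ hδ
    · refine (pdist_param_le h1.le (hlδ δ hδ)).trans ?_
      rw [add_comm, hd2 δ hδ]
    · refine (pdist_param_le h1.le (hrδ δ hδ).le).trans ?_
      rw [add_comm, hd1 δ]
  · rintro ⟨_ | _⟩ δ hδ
    · simp only [Bool.false_eq_true, if_false]
      rw [innerRad_param hl hr (hlδ δ hδ), if_pos rfl, hd2 δ hδ,
        min_eq_right (by exact_mod_cast hδ.le)]
    · simp only [if_true]
      rw [innerRad_param hl hr (hrδ δ hδ).le, if_pos rfl, hd1 δ,
        min_eq_right (by exact_mod_cast hδ.le)]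
  · rintro (b | ⟨e, t, h0', h1'⟩) h
    · exact absurd h (by simpa [innerRad] using hε0.ne')
    · rw [innerRad] at h
      split_ifs at h with hb
      · subst hb
        rw [← bot_eq_zero, min_eq_bot] at h
        rcases h with h | h
        · exact absurd h (by simpa using hε0.ne')
        · rw [bot_eq_zero, add_eq_zero, tsub_eq_zero_iff_le, tsub_eq_zero_iff_le] at h
          rw [← param_inner h0' h1', le_antisymm h.1 h.2]
      · exact absurd h (by simpa using hε0.ne')
  · rintro (b | ⟨e, t, h0', h1'⟩) δ hδ0 hδ h
    · rw [innerRad] at h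
      exact absurd h.symm (by exact_mod_cast hδ.ne)
    · rw [innerRad] at h
      split_ifs at h with hb
      · subst hb
        rcases min_choice (ε : ℝ≥0∞) ((t - t₀) + (t₀ - t)) with h2 | h2
        · rw [h2] at h
          exact absurd h.symm (by exact_mod_cast hδ.ne)
        · rw [h2] at h
          rw [← param_inner h0' h1']
          rcases le_total t t₀ with h3 | h3
          · rw [tsub_eq_zero_of_le h3, zero_add] at h
            refine ⟨⟨false⟩, ?_⟩
            simp only [Bool.false_eq_true, if_false]
            rw [← h, ENNReal.sub_sub_cancel ENNReal.coe_ne_top h3]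
          · rw [tsub_eq_zero_of_le h3, add_zero] at h
            refine ⟨⟨true⟩, ?_⟩
            simp only [if_true]
            rw [← h, add_tsub_cancel_of_le h3]
      · exact absurd h.symm (by exact_mod_cast hδ.ne)
  · intro δ hδ0 hδ
    have hne : param e₀ ((t₀ : ℝ≥0∞) + δ) ≠ param e₀ ((t₀ : ℝ≥0∞) - δ) := by
      rw [param_inner (h0.trans_le le_self_add) (hrδ δ hδ),
        param_inner (hpδ δ hδ) (tsub_le_self.trans_lt h1)]
      intro h
      injection h with h2 h3
      have h4 : (t₀ : ℝ≥0∞) < t₀ + δ :=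
        ENNReal.lt_add_right ENNReal.coe_ne_top (by exact_mod_cast hδ0.ne')
      rw [h3] at h4
      exact not_le.2 h4 tsub_le_self
    rintro ⟨_ | _⟩ ⟨_ | _⟩ h
    · rfl
    · exact absurd h.symm hne
    · exact absurd h hne
    · rfl
  · intro f hf
    refine ⟨fun b => if b.down then RatFun.slopeFwd f e₀ t₀ else RatFun.slopeBwd f e₀ t₀, ?_, ?_⟩
    · rw [param_inner h0 h1, RatFun.slopeSum, ← Equiv.ulift.symm.sum_comp]
      simp
    · obtain ⟨η, hη, h⟩ := (RatFun.isSlopeFwd_slopeFwd hf h1).apply_add h1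
      obtain ⟨η', hη', h'⟩ := (RatFun.isSlopeBwd_slopeBwd hf h0 h1.le).apply_sub
        (by exact_mod_cast h0) h1.le
      refine ⟨min η η', lt_min hη hη', ?_⟩
      rintro ⟨_ | _⟩ δ hδ
      · simpa using h' δ (hδ.trans_le (min_le_right _ _))
      · simpa using h δ (hδ.trans_le (min_le_left _ _))

theorem nonempty_star {x : Γ.Point} (hx : x ∈ Γ.finite) : Nonempty (Star x) := by
  cases x with
  | vertex a => exact nonempty_star_vertex hx
  | inner e t h0 h1 =>
    lift t to ℝ≥0 using (h1.trans_le le_top).ne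
    exact nonempty_star_inner h0 h1

/-! ### Truncated distance and small spheres -/

namespace Star

variable {x : Γ.Point} (S : Star x)

/-- The lower bound for the distance is built into `rad_le_pdist`; the upper bound comes from the
segment `γ i` through `z`. Hence the truncated distance is the rational function `fn` up to sign. -/
theorem min_pdist (z : Γ.Point) : min (S.ε : ℝ≥0∞) (pdist x z) = S.rad z := by
  refine le_antisymm ?_ (le_min (S.rad_le z) (S.rad_le_pdist z))
  rcases (S.rad_le z).lt_or_eq with h | h
  · refine (min_le_right _ _).trans ?_
    rcases eq_or_ne (S.rad z) 0 with h0 | h0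
    · rw [S.eq_of_rad_eq_zero z h0]
      simp
    · obtain ⟨δ, hδ⟩ := WithTop.ne_top_iff_exists.1 (h.trans ENNReal.coe_lt_top).ne
      replace hδ : (δ : ℝ≥0∞) = S.rad z := hδ
      rw [← hδ] at h h0 ⊢
      have hlt : δ < S.ε := by exact_mod_cast h
      obtain ⟨i, rfl⟩ := S.exists_of_rad_eq z δ (pos_iff_ne_zero.2 (by exact_mod_cast h0)) hlt hδ.symm
      exact S.pdist_le i δ hlt
  · rw [h]
    exact min_le_left _ _

theorem fn_eq (z : Γ.Point) : S.fn z = -((min (S.ε : ℝ≥0∞) (pdist x z) : ℝ≥0∞) : EReal) := by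
  rw [S.fn_apply, S.min_pdist]

/-- Together with injectivity of the branches, this recovers the set of branches at `x` from the
metric alone. -/
theorem pdist_eq_iff {δ : ℝ≥0} (h0 : 0 < δ) (h : δ < S.ε) {z : Γ.Point} :
    pdist x z = δ ↔ ∃ i, z = S.γ i δ := by
  constructor
  · intro hz
    refine S.exists_of_rad_eq z δ h0 h ?_
    rw [← S.min_pdist, hz, min_eq_right (by exact_mod_cast h.le)]
  · rintro ⟨i, rfl⟩
    refine le_antisymm (S.pdist_le i δ h) ?_
    rw [← S.rad_γ i δ h]
    exact S.rad_le_pdist _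

end Star

theorem eq_of_pdist_eq_zero {x z : Γ.Point} (hx : x ∈ Γ.finite) (h : pdist x z = 0) : z = x := by
  obtain ⟨S⟩ := nonempty_star hx
  refine S.eq_of_rad_eq_zero z ?_
  rw [← S.min_pdist, h]
  simp

theorem exists_le_neg_coe {a : EReal} (ha : a < 0) : ∃ ε : ℝ≥0, 0 < ε ∧ a ≤ -((ε : ℝ) : EReal) := by
  obtain ⟨c, h1, h2⟩ := EReal.lt_iff_exists_real_btwn.1 ha
  have hc : c < 0 := by exact_mod_cast h2
  refine ⟨Real.toNNReal (-c), Real.toNNReal_pos.2 (by linarith), h1.le.trans (le_of_eq ?_)⟩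
  rw [Real.coe_toNNReal _ (by linarith), EReal.coe_neg, neg_neg]

/-- Among the rational functions with strict maximum `0` at a finite point `x`, the negative
distance to `x` is locally the largest. -/
theorem exists_le_neg_min_pdist {x : Γ.Point} (hx : x ∈ Γ.finite) {g : RatFun Γ} (h0 : g x = 0)
    (hneg : ∀ z, z ≠ x → g z < 0) :
    ∃ ε : ℝ≥0, 0 < ε ∧ ∀ z, g z ≤ -((min (ε : ℝ≥0∞) (pdist x z) : ℝ≥0∞) : EReal) := by
  obtain ⟨S⟩ := nonempty_star hx
  have hg : g ≠ 0 := by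
    intro h
    rw [RatFun.eq_zero_iff.1 h x] at h0
    exact EReal.bot_ne_zero h0
  obtain ⟨m, -, η, hη, hm⟩ := S.slopes g hg
  obtain ⟨δ₀, hδ₀, hδη⟩ := exists_between (lt_min hη S.pos)
  -- A strict maximum forces every outgoing slope to be negative, and integrality then gives at
  -- least unit descent.
  have hm1 : ∀ i, m i ≤ -1 := by
    intro i
    have h1 := hneg (S.γ i δ₀) (fun h => by
      have := S.rad_γ i δ₀ (hδη.trans_le (min_le_right _ _))
      have h2 := S.rad_le_pdist (S.γ i δ₀)
      rw [this, h, pdist_self] at h2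
      exact hδ₀.ne' (by simpa using h2))
    rw [hm i δ₀ (hδη.trans_le (min_le_left _ _)), h0, zero_add] at h1
    have h2 : (m i : ℝ) * δ₀ < 0 := by exact_mod_cast h1
    have h3 : (m i : ℝ) < 0 := neg_of_mul_neg_left h2 δ₀.2
    have h4 : m i < 0 := by exact_mod_cast h3
    omega
  -- This is the complement of the open ball of radius `δ₀`. On it `g` is negative and attains its
  -- maximum, so a uniform `ε` works there; inside the ball the slope bound suffices.
  have hK : IsCompact {z | S.fn z ≤ -((δ₀ : ℝ) : EReal)} :=
    (isClosed_le S.fn.cont continuous_const).isCompact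
  have hKx : ∀ z, S.fn z ≤ -((δ₀ : ℝ) : EReal) → z ≠ x := by
    rintro z hz rfl
    rw [S.fn_eq, pdist_self] at hz
    have : (δ₀ : ℝ) ≤ 0 := by
      have := EReal.neg_le_neg_iff.1 hz
      simpa using this
    exact absurd this (not_le.2 hδ₀)
  obtain ⟨ε, hε, hεK⟩ : ∃ ε : ℝ≥0, 0 < ε ∧
      ∀ z, S.fn z ≤ -((δ₀ : ℝ) : EReal) → g z ≤ -((ε : ℝ) : EReal) := by
    rcases {z | S.fn z ≤ -((δ₀ : ℝ) : EReal)}.eq_empty_or_nonempty with h | h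
    · exact ⟨1, one_pos, fun z hz => absurd (show z ∈ {z | S.fn z ≤ -((δ₀ : ℝ) : EReal)} from hz)
        (by rw [h]; simp)⟩
    · obtain ⟨z₀, hz₀, hmax⟩ := hK.exists_isMaxOn h g.cont.continuousOn
      obtain ⟨ε, hε, hle⟩ := exists_le_neg_coe (hneg z₀ (hKx z₀ hz₀))
      exact ⟨ε, hε, fun z hz => (hmax hz).trans hle⟩
  refine ⟨ε, hε, fun z => ?_⟩
  rcases lt_or_ge (S.rad z) δ₀ with h | h
  · rcases eq_or_ne z x with rfl | hzx
    · simp [h0]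
    obtain ⟨δ, hδ⟩ := WithTop.ne_top_iff_exists.1 (h.trans ENNReal.coe_lt_top).ne
    replace hδ : (δ : ℝ≥0∞) = S.rad z := hδ
    rw [← hδ] at h
    have hlt : δ < min η S.ε := lt_trans (by exact_mod_cast h) hδη
    have hpos : 0 < δ := pos_iff_ne_zero.2 fun h => hzx (S.eq_of_rad_eq_zero z (by simp [← hδ, h]))
    obtain ⟨i, rfl⟩ := S.exists_of_rad_eq z δ hpos (hlt.trans_le (min_le_right _ _)) hδ.symm
    rw [hm i δ (hlt.trans_le (min_le_left _ _)), h0, zero_add]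
    refine le_trans ?_ (EReal.neg_le_neg_iff.2 (EReal.coe_ennreal_le_coe_ennreal_iff.2
      ((min_le_right _ _).trans (S.pdist_le i δ (hlt.trans_le (min_le_right _ _))))))
    rw [coe_coe_ereal, ← EReal.coe_neg, EReal.coe_le_coe_iff]
    have h3 : (m i : ℝ) ≤ -1 := by exact_mod_cast hm1 i
    nlinarith [δ.2]
  · refine (hεK z ?_).trans ?_
    · rw [S.fn_apply, EReal.neg_le_neg_iff, ← coe_coe_ereal]
      exact EReal.coe_ennreal_le_coe_ennreal_iff.2 h
    · rw [EReal.neg_le_neg_iff, ← coe_coe_ereal]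
      exact EReal.coe_ennreal_le_coe_ennreal_iff.2 (min_le_left _ _)

end TropicalCurve

/-! ### Rays towards points at infinity, and separation of points -/

namespace TropicalCurve

variable {Γ : TropicalCurve.{u, v}}

open Classical in
/-- The distance to the complement of `ray e s`. -/
noncomputable def rayDist (e : Γ.E) (s : ℝ≥0) : Γ.Point → ℝ≥0∞
  | Point.vertex b => if b = Γ.tgt e then ⊤ else 0
  | Point.inner e' t _ _ => if e' = e then t - s else 0

open Classical in
theorem rayDist_param {e : Γ.E} (he : Γ.len e = ⊤) (s : ℝ≥0) {e' : Γ.E} {t : ℝ≥0∞}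
    (ht : t ≤ Γ.len e') : rayDist e s (param e' t) = if e' = e then t - s else 0 := by
  rcases eq_or_ne t 0 with rfl | h0
  · rw [param_zero, rayDist, if_neg (leaf_unique he e').1]
    simp
  rcases ht.lt_or_eq with h1 | rfl
  · rw [param_inner (pos_iff_ne_zero.2 h0) h1, rayDist]
  · rw [param_len, rayDist]
    by_cases h : e' = e
    · subst h
      rw [if_pos rfl, if_pos rfl, he, ENNReal.top_sub_coe]
    · rw [if_neg h, if_neg fun h' => h ((leaf_unique he e').2 h')]

theorem rayDist_param_self {e : Γ.E} (he : Γ.len e = ⊤) (s : ℝ≥0) (t : ℝ≥0∞) :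
    rayDist e s (param e t) = t - s := by
  rw [rayDist_param he s (by simp [he]), if_pos rfl]

theorem exists_of_rayDist_ne_zero {e : Γ.E} (he : Γ.len e = ⊤) {s : ℝ≥0} {z : Γ.Point}
    (h : rayDist e s z ≠ 0) : ∃ t : ℝ≥0∞, s < t ∧ z = param e t := by
  rcases z with b | ⟨e', t, h0, h1⟩
  · rw [rayDist] at h
    split_ifs at h with hb
    · exact ⟨⊤, ENNReal.coe_lt_top, by rw [param_top he, hb]⟩
    · exact absurd rfl h
  · rw [rayDist] at h
    split_ifs at h with hb
    · subst hb
      exact ⟨t, tsub_pos_iff_lt.1 (pos_iff_ne_zero.2 h), (param_inner h0 h1).symm⟩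
    · exact absurd rfl h

theorem rayDist_eq_zero_iff {e : Γ.E} (he : Γ.len e = ⊤) {s : ℝ≥0} {z : Γ.Point} :
    rayDist e s z = 0 ↔ z ∉ ray e s := by
  constructor
  · rintro h ⟨t, hst, rfl⟩
    rw [rayDist_param_self he] at h
    exact (tsub_pos_of_lt hst).ne' h
  · intro h
    by_contra h'
    exact h (exists_of_rayDist_ne_zero he h')

theorem rayDist_eq_top {e : Γ.E} {s : ℝ≥0} {z : Γ.Point} (h : rayDist e s z = ⊤) :
    z = Point.vertex (Γ.tgt e) := by
  rcases z with b | ⟨e', t, h0, h1⟩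
  · rw [rayDist] at h
    split_ifs at h with hb
    · rw [hb]
    · simp at h
  · rw [rayDist] at h
    split_ifs at h with hb
    · exact absurd h (ne_top_of_le_ne_top (h1.trans_le le_top).ne tsub_le_self)
    · simp at h

/-- The end `param e s` of the ray realizes the upper bound. For the lower bound, `rayDist` is
1-Lipschitz and vanishes on the complement. -/
theorem distTo_compl_ray {e : Γ.E} (he : Γ.len e = ⊤) (s : ℝ≥0) (z : Γ.Point) :
    distTo z (ray e s)ᶜ = rayDist e s z := by
  classical
  apply le_antisymm
  · by_cases h : z ∈ ray e s
    · obtain ⟨t, hst, rfl⟩ := h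
      have hs : param e s ∈ (ray e s)ᶜ := by
        rw [mem_compl_iff, ← rayDist_eq_zero_iff he, rayDist_param_self he, tsub_self]
      refine (iInf₂_le _ hs).trans ((pdist_param_le (by simp [he]) (by simp [he])).trans ?_)
      rw [rayDist_param_self he, tsub_eq_zero_of_le hst.le, add_zero]
    · refine (iInf₂_le z h).trans ?_
      simp
  · refine le_iInf₂ fun y hy => ?_
    have h := le_add_pdist (h := rayDist e s) (fun e' a b ha hb => ?_) z y
    · rwa [(rayDist_eq_zero_iff he).2 hy, zero_add] at h
    · rw [rayDist_param he s ha, rayDist_param he s hb]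
      split_ifs
      · exact (tsub_le_tsub_add_tsub (b := b)).trans
          (by rw [add_comm]; gcongr; exact le_self_add)
      · simp

theorem continuous_rayDist {e : Γ.E} (he : Γ.len e = ⊤) (s : ℝ≥0) : Continuous (rayDist e s) := by
  classical
  rw [continuous_iff_edgewise]
  intro e'
  have h : (fun t : Icc (0 : ℝ≥0∞) (Γ.len e') => rayDist e s (param e' t)) = fun t : Icc (0 : ℝ≥0∞) (Γ.len e') =>
      if e' = e then t.1 - s else 0 := funext fun t => rayDist_param he s t.2.2
  rw [h]
  split_ifs
  · exact (ENNReal.continuous_sub_right _).comp continuous_subtype_val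
  · exact continuous_const

theorem isPiecewiseAffineOn_neg_rayDist {e : Γ.E} (he : Γ.len e = ⊤) (s : ℝ≥0) (e' : Γ.E) :
    IsPiecewiseAffineOn (fun z => -(rayDist e s z : EReal)) e' := by
  by_cases h : e' = e
  · refine IsPiecewiseAffineOn.congr_inner ((isPiecewiseAffineOn_affine 0 0 e').sup
      (isPiecewiseAffineOn_affine 1 (-(s : ℝ)) e')).neg fun t h0 h1 => ?_
    rw [h] at h1 ⊢
    rw [rayDist_param_self he, affine_param h0 h1, affine_param h0 h1, ← ENNReal.coe_sub,
      coe_coe_ereal, NNReal.coe_sub_def, ← EReal.coe_strictMono.monotone.map_max]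
    congr 2
    rw [max_comm]
    simp [sub_eq_add_neg]
  · refine IsPiecewiseAffineOn.congr_inner (isPiecewiseAffineOn_affine 0 0 e')
      fun t h0 h1 => ?_
    rw [affine_param h0 h1, rayDist_param he s h1.le, if_neg h]
    simp

/-- The chip-firing move by the complement of `ray e s`, as a rational function. -/
noncomputable def rayFn {e : Γ.E} (he : Γ.len e = ⊤) (s : ℝ≥0) : RatFun Γ where
  toFun z := -(rayDist e s z : EReal)
  cont := coe_ereal_continuous_neg (continuous_rayDist he s)
  rational := Or.inr ⟨fun z hz => by
    have : rayDist e s z ≠ ⊤ := fun h => hz ⟨e, he, rayDist_eq_top h⟩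
    lift rayDist e s z to ℝ≥0 using this with a
    exact neg_coe_ne (le_refl (a : ℝ≥0∞)), isPiecewiseAffineOn_neg_rayDist he s⟩

theorem rayFn_apply {e : Γ.E} (he : Γ.len e = ⊤) (s : ℝ≥0) (z : Γ.Point) :
    rayFn he s z = -(rayDist e s z : EReal) := rfl

/-- One function singles out one point at infinity. This is how infinite points are told apart from
finite ones and from each other. -/
theorem rayFn_eq_bot_iff {e : Γ.E} (he : Γ.len e = ⊤) (s : ℝ≥0) (z : Γ.Point) :
    rayFn he s z = ⊥ ↔ z = Point.vertex (Γ.tgt e) := by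
  rw [rayFn_apply, EReal.neg_eq_bot_iff, EReal.coe_ennreal_eq_top_iff]
  refine ⟨rayDist_eq_top, ?_⟩
  rintro rfl
  rw [rayDist, if_pos rfl]

/-- At a finite point the truncated distance vanishes only there; at an infinite point `rayFn` is
`⊥` only there. -/
theorem exists_ratFun_ne {x y : Γ.Point} (h : x ≠ y) : ∃ f : RatFun Γ, f x ≠ f y := by
  by_cases hx : x ∈ Γ.finite
  · obtain ⟨S⟩ := nonempty_star hx
    refine ⟨S.fn, fun h' => h ?_⟩
    rw [S.fn_eq, S.fn_eq, pdist_self, neg_inj, EReal.coe_ennreal_eq_coe_ennreal_iff] at h'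
    have h2 := h'.symm
    rw [min_eq_right (zero_le : 0 ≤ (S.ε : ℝ≥0∞)), ← bot_eq_zero, min_eq_bot] at h2
    rcases h2 with h2 | h2
    · exact absurd h2 (by simpa using S.pos.ne')
    · exact (eq_of_pdist_eq_zero hx h2).symm
  · obtain ⟨e, he, rfl⟩ := not_not.1 hx
    refine ⟨rayFn he 0, fun h' => h ?_⟩
    rw [(rayFn_eq_bot_iff he 0 _).2 rfl] at h'
    exact ((rayFn_eq_bot_iff he 0 _).1 h'.symm).symm

end TropicalCurve

/-! ### Inverses, constants and roots in the semiring -/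

namespace RatFun

open TropicalCurve

variable {Γ : TropicalCurve.{u, v}}

theorem mul_apply (f g : RatFun Γ) {x : Γ.Point} (hx : x ∈ Γ.finite) : (f * g) x = f x + g x :=
  tropMul_apply f g hx

theorem add_apply (f g : RatFun Γ) (x : Γ.Point) : (f + g) x = max (f x) (g x) := rfl

theorem const_apply (c : ℝ) (x : Γ.Point) : const Γ c x = c := rfl

theorem continuous_add_coe (c : ℝ) : Continuous (fun a : EReal => a + c) := by
  rw [continuous_iff_continuousAt]
  intro a
  exact (EReal.continuousAt_add (p := (a, (c : EReal))) (Or.inr (EReal.coe_ne_bot c))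
    (Or.inr (EReal.coe_ne_top c))).comp (f := fun a : EReal => (a, (c : EReal))) (by fun_prop)

/-- Adding a real constant is continuous on all of `EReal`, so for this product the pointwise
formula persists at points at infinity. -/
theorem mul_const_apply (f : RatFun Γ) (c : ℝ) (x : Γ.Point) : (f * const Γ c) x = f x + c :=
  congrFun (Continuous.ext_on (dense_finite Γ) (f * const Γ c).cont
    ((continuous_add_coe c).comp f.cont) fun _ hx => mul_apply f _ hx) x

/-- The inverse of `f` for `⊙`: its pointwise negative. -/
noncomputable def inv (f : RatFun Γ) (hf : f ≠ 0) : RatFun Γ where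
  toFun x := -f x
  cont := continuous_neg.comp f.cont
  rational := Or.inr ⟨fun x hx => by
    simpa [and_comm] using (rational_of_ne_zero hf).1 x hx, fun e => ((rational_of_ne_zero hf).2 e).neg⟩

theorem inv_apply (f : RatFun Γ) (hf : f ≠ 0) (x : Γ.Point) : inv f hf x = -f x := rfl

theorem exists_real_eq {f : RatFun Γ} (hf : f ≠ 0) {x : Γ.Point} (hx : x ∈ Γ.finite) :
    ∃ a : ℝ, f x = a := by
  obtain ⟨h1, h2⟩ := (rational_of_ne_zero hf).1 x hx
  exact ⟨_, (EReal.coe_toReal h2 h1).symm⟩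

theorem one_eq_const : (1 : RatFun Γ) = const Γ 0 := rfl

theorem mul_inv (f : RatFun Γ) (hf : f ≠ 0) : f * inv f hf = 1 := ext_finite fun x hx => by
  obtain ⟨a, ha⟩ := exists_real_eq hf hx
  rw [mul_apply _ _ hx, inv_apply, ha, one_eq_const, const_apply, ← EReal.coe_neg, ← EReal.coe_add]
  simp

theorem const_mul_const (a b : ℝ) : const Γ a * const Γ b = const Γ (a + b) := ext fun x => by
  rw [mul_const_apply]
  simp [const_apply]

theorem const_add_const (a b : ℝ) : const Γ a + const Γ b = const Γ (max a b) := ext fun x => by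
  rw [add_apply, const_apply, const_apply, const_apply, EReal.coe_strictMono.monotone.map_max]

theorem const_pow (a : ℝ) (n : ℕ) : const Γ a ^ n = const Γ (n * a) := by
  induction n with
  | zero => simp [one_eq_const]
  | succ n ih =>
    rw [pow_succ, ih, const_mul_const]
    push_cast
    ring_nf

theorem nonempty_finite (Γ : TropicalCurve.{u, v}) : Γ.finite.Nonempty :=
  have : Nonempty Γ.Point := Γ.nonemptyV.map Point.vertex
  (dense_finite Γ).nonempty

theorem const_injective : Function.Injective (const Γ) := fun a b h => by
  obtain ⟨x, -⟩ := nonempty_finite Γ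
  have := congrArg (fun f : RatFun Γ => f x) h
  exact EReal.coe_injective this

theorem const_ne_zero (c : ℝ) : const Γ c ≠ 0 := fun h => by
  obtain ⟨x, -⟩ := nonempty_finite Γ
  exact EReal.coe_ne_bot c (eq_zero_iff.1 h x)

theorem add_const_eq_iff (f : RatFun Γ) (c : ℝ) : f + const Γ c = f ↔ ∀ x, (c : EReal) ≤ f x := by
  constructor
  · intro h x
    rw [← h, add_apply]
    exact le_max_right _ _
  · exact fun h => ext fun x => max_eq_left (h x)

theorem pow_apply (g : RatFun Γ) (n : ℕ) {x : Γ.Point} (hx : x ∈ Γ.finite) :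
    (g ^ n) x = n • g x := by
  induction n with
  | zero => simp [one_eq_const, const_apply]
  | succ n ih => rw [pow_succ, mul_apply _ _ hx, ih, succ_nsmul]

/-- A rational function with `n`-th roots for all `n` has only slopes `0`. -/
theorem slope_eq_zero_of_roots {f : RatFun Γ} (hf : f ≠ 0)
    (hroots : ∀ n : ℕ, 0 < n → ∃ g : RatFun Γ, g ^ n = f) {l : Filter ℝ≥0∞} [l.NeBot] {e : Γ.E}
    (hl : ∀ᶠ s in l, s < Γ.len e) (hl' : ∀ w : ℝ≥0∞, ∀ᶠ s in l, s ≠ w) {m : ℤ} {c : ℝ}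
    (hm : ∀ᶠ s : ℝ≥0∞ in l, f (param e s) = (((m : ℝ) * s.toReal + c : ℝ) : EReal))
    (hg : ∀ g : RatFun Γ, g ≠ 0 → ∃ (k : ℤ) (d : ℝ),
      ∀ᶠ s : ℝ≥0∞ in l, g (param e s) = (((k : ℝ) * s.toReal + d : ℝ) : EReal)) : m = 0 := by
  -- The exponent `|m| + 1` must divide `m` and exceeds `|m|`, which leaves only `m = 0`.
  obtain ⟨g, hgf⟩ := hroots (m.natAbs + 1) (by omega)
  have hg0 : g ≠ 0 := by
    rintro rfl
    exact hf (by rw [← hgf]; simp)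
  obtain ⟨k, d, hk⟩ := hg g hg0
  have hall : ∀ᶠ s : ℝ≥0∞ in l,
      (m : ℝ) * s.toReal + c = (m.natAbs + 1 : ℕ) * ((k : ℝ) * s.toReal + d) := by
    filter_upwards [hl, hm, hk] with s h1 h2 h3
    have h4 := pow_apply g (m.natAbs + 1) (param_mem_finite h1)
    rw [hgf, h2, h3, ← EReal.coe_nsmul, EReal.coe_eq_coe_iff, nsmul_eq_mul] at h4
    exact h4
  -- Two distinct parameters eliminate the constant terms and isolate the slopes.
  obtain ⟨s, hs, hs1⟩ := (hall.and hl).exists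
  obtain ⟨t, ⟨ht, ht1⟩, hts⟩ := ((hall.and hl).and (hl' s)).exists
  have hne : t.toReal - s.toReal ≠ 0 := by
    intro h
    exact hts ((ENNReal.toReal_eq_toReal_iff' (ht1.trans_le le_top).ne (hs1.trans_le le_top).ne).1
      (sub_eq_zero.1 h))
  have hmk : (m : ℝ) = (m.natAbs + 1 : ℕ) * k :=
    mul_right_cancel₀ hne (by linear_combination ht - hs)
  have hmk' : m = (m.natAbs + 1 : ℕ) * k :=
    Int.cast_injective (α := ℝ) (by rw [Int.cast_mul, Int.cast_natCast]; exact hmk)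
  have hdvd : ((m.natAbs + 1 : ℕ) : ℤ) ∣ m := ⟨k, hmk'⟩
  refine Int.eq_zero_of_abs_lt_dvd hdvd ?_
  rw [Int.abs_eq_natAbs]
  push_cast
  omega

end RatFun

namespace RatFun

open TropicalCurve

variable {Γ : TropicalCurve.{u, v}}

theorem eq_of_eventually_zero_slope {f : RatFun Γ} {e : Γ.E} {t : ℝ≥0∞} (ht : t ≤ Γ.len e)
    {l : Filter ℝ≥0∞} [l.NeBot] (hl : l ≤ 𝓝[Icc 0 (Γ.len e)] t) {m : ℝ} (hm : m = 0) {c : ℝ}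
    (h : ∀ᶠ s : ℝ≥0∞ in l, f (param e s) = ((m * s.toReal + c : ℝ) : EReal)) :
    ∀ᶠ s : ℝ≥0∞ in l, f (param e s) = f (param e t) := by
  subst hm
  have h1 : Tendsto (fun s => f (param e s)) l (𝓝 (f (param e t))) :=
    (f.continuousOn_param e _ ⟨zero_le, ht⟩).mono_left hl
  have h2 : ∀ᶠ s : ℝ≥0∞ in l, f (param e s) = (c : EReal) := h.mono fun s hs => by simpa using hs
  have h3 := tendsto_nhds_unique h1 (tendsto_const_nhds.congr' (h2.mono fun _ h => h.symm))
  rw [h3]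
  exact h2

theorem eventually_eq_of_roots {f : RatFun Γ} (hf : f ≠ 0)
    (hroots : ∀ n : ℕ, 0 < n → ∃ g : RatFun Γ, g ^ n = f) {e : Γ.E} {t : ℝ≥0∞}
    (ht : t ≤ Γ.len e) : ∀ᶠ s in 𝓝 t, s ≤ Γ.len e → f (param e s) = f (param e t) := by
  have hleft : ∀ᶠ s in 𝓝 t, s < t → f (param e s) = f (param e t) := by
    rcases eq_or_ne t 0 with rfl | h0
    · exact Eventually.of_forall fun s hs => absurd hs (by simp)
    have h0 := pos_iff_ne_zero.2 h0
    have : (𝓝[<] t).NeBot := nhdsLT_neBot_of_exists_lt ⟨0, h0⟩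
    obtain ⟨c, hc⟩ := isSlopeBwd_slopeBwd hf h0 ht
    have hc' : ∀ᶠ s : ℝ≥0∞ in 𝓝[<] t,
        f (param e s) = ((((-slopeBwd f e t : ℤ) : ℝ) * s.toReal + c : ℝ) : EReal) := by
      simpa using hc
    have hm := slope_eq_zero_of_roots hf hroots (l := 𝓝[<] t)
      (by filter_upwards [self_mem_nhdsWithin] with s hs using lt_of_lt_of_le hs ht)
      (fun w => ?_) hc' (fun g hg => ?_)
    · refine eventually_nhdsWithin_iff.1
        (eq_of_eventually_zero_slope ht (l := 𝓝[<] t) ?_ (by simp [hm]) hc')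
      exact nhdsWithin_le_of_mem
        (mem_of_superset (Ioo_mem_nhdsLT h0) fun s hs => ⟨zero_le, hs.2.le.trans ht⟩)
    · rcases lt_or_ge w t with h | h
      · filter_upwards [Ioo_mem_nhdsLT h] with s hs using hs.1.ne'
      · filter_upwards [self_mem_nhdsWithin] with s hs using (lt_of_lt_of_le hs h).ne
    · obtain ⟨d, hd⟩ := isSlopeBwd_slopeBwd hg h0 ht
      exact ⟨-slopeBwd g e t, d, by simpa using hd⟩
  have hright : ∀ᶠ s in 𝓝 t, t < s → s ≤ Γ.len e → f (param e s) = f (param e t) := by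
    rcases ht.lt_or_eq with hlt | rfl
    · have : (𝓝[>] t).NeBot := nhdsGT_neBot_of_exists_gt ⟨_, hlt⟩
      lift t to ℝ≥0 using (hlt.trans_le le_top).ne
      obtain ⟨c, hc⟩ := isSlopeFwd_slopeFwd hf hlt
      have hm := slope_eq_zero_of_roots hf hroots (l := 𝓝[>] (t : ℝ≥0∞))
        (by filter_upwards [Ioo_mem_nhdsGT hlt] with s hs using hs.2)
        (fun w => ?_) hc (fun g hg => ⟨_, isSlopeFwd_slopeFwd hg hlt⟩)
      · refine (eventually_nhdsWithin_iff.1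
          (eq_of_eventually_zero_slope ht ?_ (by simp [hm]) hc)).mono fun s h1 h2 _ => h1 h2
        exact nhdsWithin_le_of_mem
          (mem_of_superset (Ioo_mem_nhdsGT hlt) fun s hs => ⟨zero_le, hs.2.le⟩)
      · rcases lt_or_ge (t : ℝ≥0∞) w with h | h
        · filter_upwards [Ioo_mem_nhdsGT h] with s hs using hs.2.ne
        · filter_upwards [self_mem_nhdsWithin] with s hs using (lt_of_le_of_lt h hs).ne'
    · exact Eventually.of_forall fun s h1 h2 => absurd h2 (not_le.2 h1)
  filter_upwards [hleft, hright] with s h1 h2 hs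
  rcases lt_trichotomy s t with h | rfl | h
  · exact h1 h
  · rfl
  · exact h2 h hs

/-- All slopes vanish, so `f` is locally constant on each closed edge. Connectedness of the interval
and then of the graph makes it globally constant, and its value is real because some point is
finite. -/
theorem exists_eq_const_of_roots {f : RatFun Γ} (hf : f ≠ 0)
    (hroots : ∀ n : ℕ, 0 < n → ∃ g : RatFun Γ, g ^ n = f) : ∃ c, f = const Γ c := by
  have hedge : ∀ e (t : ℝ≥0∞), t ≤ Γ.len e → f (param e t) = f (Point.vertex (Γ.src e)) := by
    intro e t ht
    have : PreconnectedSpace (Icc (0 : ℝ≥0∞) (Γ.len e)) :=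
      Subtype.preconnectedSpace isPreconnected_Icc
    have hloc : IsLocallyConstant (fun t : Icc (0 : ℝ≥0∞) (Γ.len e) => f (param e t)) := by
      rw [IsLocallyConstant.iff_eventually_eq]
      intro t
      have := (eventually_eq_of_roots hf hroots t.2.2)
      exact (continuous_subtype_val.tendsto t).eventually this |>.mono fun s hs => hs s.2.2
    have := hloc.apply_eq_of_preconnectedSpace ⟨t, zero_le, ht⟩ ⟨0, le_rfl, zero_le⟩
    simpa [param_zero] using this
  have hvert : ∀ a b : Γ.V, f (Point.vertex a) = f (Point.vertex b) := by
    intro a b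
    induction Γ.connected a b with
    | rel a b h =>
      obtain ⟨e, rfl, rfl⟩ := h
      rw [← hedge e (Γ.len e) le_rfl, param_len]
    | refl => rfl
    | symm _ _ _ ih => exact ih.symm
    | trans _ _ _ _ _ ih1 ih2 => exact ih1.trans ih2
  obtain ⟨a⟩ := Γ.nonemptyV
  have hall : ∀ x, f x = f (Point.vertex a) := by
    rintro (b | ⟨e, t, h0, h1⟩)
    · exact hvert b a
    · rw [← param_inner h0 h1, hedge e t h1.le]
      exact hvert _ a
  obtain ⟨x, hx⟩ := nonempty_finite Γ
  obtain ⟨c, hc⟩ := exists_real_eq hf hx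
  exact ⟨c, ext fun y => by rw [hall y, ← hall x, hc, const_apply]⟩

end RatFun

/-! ### The scaling factor and the transported point map -/

section Isomorphism

open TropicalCurve RatFun

variable {Γ₁ : TropicalCurve.{u, v}} {Γ₂ : TropicalCurve.{u', v'}}

/-- Existence of roots is a semiring property, and `c / n` is an `n`-th root of the constant `c`. -/
theorem exists_map_const (ψ : RatFun Γ₁ ≃+* RatFun Γ₂) (c : ℝ) :
    ∃ d, ψ (const Γ₁ c) = const Γ₂ d := by
  refine exists_eq_const_of_roots (by simpa using const_ne_zero c) fun n hn => ?_
  refine ⟨ψ (const Γ₁ (c / n)), ?_⟩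
  rw [← map_pow, const_pow, mul_div_cancel₀]
  exact_mod_cast hn.ne'

/-- Additivity settles rational arguments; monotonicity squeezes a real one between them. -/
theorem monotone_additive_eq_mul {ρ : ℝ →+ ℝ} (h : Monotone ρ) (c : ℝ) : ρ c = ρ 1 * c := by
  have hq : ∀ q : ℚ, ρ q = ρ 1 * q := fun q => by
    have := map_rat_smul ρ q (1 : ℝ)
    simpa [mul_comm, Rat.smul_def] using this
  have h0 : 0 ≤ ρ 1 := by simpa using h zero_le_one
  rcases h0.eq_or_lt with h0 | h0
  · obtain ⟨q, hq1⟩ := exists_rat_gt c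
    obtain ⟨p, hp1⟩ := exists_rat_lt c
    have h1 := h hq1.le
    have h2 := h hp1.le
    rw [hq, ← h0] at h1 h2
    rw [← h0]
    linarith
  · rcases lt_trichotomy (ρ c) (ρ 1 * c) with hlt | heq | hgt
    · obtain ⟨q, h1, h2⟩ := exists_rat_btwn ((div_lt_iff₀' h0).2 hlt)
      have h3 := h h2.le
      rw [hq] at h3
      rw [div_lt_iff₀' h0] at h1
      linarith
    · exact heq
    · obtain ⟨q, h1, h2⟩ := exists_rat_btwn ((lt_div_iff₀' h0).2 hgt)
      have h3 := h h1.le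
      rw [hq] at h3
      rw [lt_div_iff₀' h0] at h2
      linarith

theorem exists_scale (ψ : RatFun Γ₁ ≃+* RatFun Γ₂) :
    ∃ r : ℝ, 0 < r ∧ ∀ c, ψ (const Γ₁ c) = const Γ₂ (r * c) := by
  choose ρ hρ using exists_map_const ψ
  have hadd : ∀ a b, ρ (a + b) = ρ a + ρ b := fun a b => const_injective (Γ := Γ₂) (by
    rw [← hρ, ← const_mul_const, map_mul, hρ, hρ, const_mul_const])
  -- The relation `a ≤ b` reads `a ⊕ b = b`, which `ψ` preserves.
  have hmono : Monotone ρ := fun a b hab => by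
    have : const Γ₂ (max (ρ a) (ρ b)) = const Γ₂ (ρ b) := by
      rw [← const_add_const, ← hρ, ← hρ, ← map_add, const_add_const, max_eq_right hab]
    exact max_eq_right_iff.1 (const_injective this)
  have hmul := monotone_additive_eq_mul (ρ := AddMonoidHom.mk' ρ hadd) hmono
  simp only [AddMonoidHom.mk'_apply] at hmul
  have h0 : ρ 0 = 0 := by rw [hmul, mul_zero]
  refine ⟨ρ 1, (h0 ▸ hmono zero_le_one : (0 : ℝ) ≤ ρ 1).lt_of_ne fun h => ?_, fun c => ?_⟩
  · have : const Γ₁ 0 = const Γ₁ 1 := ψ.injective (by rw [hρ, hρ, h0, ← h])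
    exact zero_ne_one (const_injective this)
  · rw [hρ, hmul]

/-- `φ` transports rational functions by `ψ`, up to the factor `r`. -/
structure IsTransport (ψ : RatFun Γ₁ ≃+* RatFun Γ₂) (r : ℝ) (φ : Γ₁.Point ≃ Γ₂.Point) : Prop where
  pos : 0 < r
  apply : ∀ f x, ψ f (φ x) = (r : EReal) * f x

theorem add_coe_neg_nonpos_iff {a : EReal} {c : ℝ} : a + ((-c : ℝ) : EReal) ≤ 0 ↔ a ≤ c := by
  induction a with
  | bot => simp
  | top => simp
  | coe a =>
    rw [← EReal.coe_add, ← EReal.coe_zero, EReal.coe_le_coe_iff, EReal.coe_le_coe_iff]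
    constructor <;> intro h <;> linarith

/-- This is the finite intersection property on a compact space: `f ⊕ g` dominates `f` and `g`,
which makes the closed sets `A f` directed. -/
theorem exists_forall_map_nonpos (ψ : RatFun Γ₁ ≃+* RatFun Γ₂) {r : ℝ} (hr : 0 < r)
    (hc : ∀ c, ψ (const Γ₁ c) = const Γ₂ (r * c)) (x : Γ₁.Point) :
    ∃ x' : Γ₂.Point, ∀ f : RatFun Γ₁, f x ≤ 0 → ψ f x' ≤ 0 := by
  let A : {f : RatFun Γ₁ // f x ≤ 0} → Set Γ₂.Point := fun f => {x' | ψ f x' ≤ 0}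
  have hA : ∀ f, IsClosed (A f) := fun f => isClosed_le (ψ f).cont continuous_const
  have hne : ∀ f, (A f).Nonempty := by
    rintro ⟨f, hf⟩
    by_contra hempty
    -- If `ψ f` were positive everywhere, it would absorb a constant `δ > 0` under `⊕`. Then `f`
    -- would absorb `δ / r`, contradicting `f x ≤ 0`.
    have hpos : ∀ x', 0 < ψ f x' := fun x' => by
      by_contra h
      exact hempty ⟨x', not_lt.1 h⟩
    have : Nonempty Γ₂.Point := Γ₂.nonemptyV.map Point.vertex
    obtain ⟨x₀, -, hmin⟩ := isCompact_univ.exists_isMinOn univ_nonempty (ψ f).cont.continuousOn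
    obtain ⟨δ, hδ0, hδ⟩ := EReal.lt_iff_exists_real_btwn.1 (hpos x₀)
    have hδ0 : 0 < δ := by exact_mod_cast hδ0
    have h1 : ψ f + const Γ₂ δ = ψ f :=
      (add_const_eq_iff _ _).2 fun x' => hδ.le.trans (hmin (mem_univ x'))
    have h2 : f + const Γ₁ (δ / r) = f := ψ.injective (by
      rw [map_add, hc, mul_div_cancel₀ _ hr.ne', h1])
    have h3 := ((add_const_eq_iff _ _).1 h2 x).trans hf
    exact absurd (show δ / r ≤ 0 by exact_mod_cast h3) (not_le.2 (div_pos hδ0 hr))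
  have hdir : Directed (· ⊇ ·) A := by
    rintro ⟨f, hf⟩ ⟨g, hg⟩
    refine ⟨⟨f + g, by rw [add_apply]; exact max_le hf hg⟩, fun x' h => ?_, fun x' h => ?_⟩
    · have h : ψ (f + g) x' ≤ 0 := h
      rw [map_add, add_apply] at h
      exact (le_max_left _ _).trans h
    · have h : ψ (f + g) x' ≤ 0 := h
      rw [map_add, add_apply] at h
      exact (le_max_right _ _).trans h
  have : Nonempty {f : RatFun Γ₁ // f x ≤ 0} := ⟨⟨0, bot_le⟩⟩
  obtain ⟨x', hx'⟩ := IsCompact.nonempty_iInter_of_directed_nonempty_isCompact_isClosed A hdir hne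
    (fun f => (hA f).isCompact) hA
  exact ⟨x', fun f hf => mem_iInter.1 hx' ⟨f, hf⟩⟩

/-- Shifting by constants turns the sign condition into all real upper bounds, and `⊙`-inverses give
the lower bounds. Real bounds on both sides determine an extended real value; only the constant
`-∞`, which has no inverse, needs separate treatment. -/
theorem exists_forall_map_eq (ψ : RatFun Γ₁ ≃+* RatFun Γ₂) {r : ℝ} (hr : 0 < r)
    (hc : ∀ c, ψ (const Γ₁ c) = const Γ₂ (r * c)) (x : Γ₁.Point) :
    ∃ x' : Γ₂.Point, ∀ f : RatFun Γ₁, ψ f x' = (r : EReal) * f x := by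
  obtain ⟨x', hx'⟩ := exists_forall_map_nonpos ψ hr hc x
  have hle : ∀ (f : RatFun Γ₁) (c : ℝ), f x ≤ c → ψ f x' ≤ ((r * c : ℝ) : EReal) := by
    intro f c h
    have h1 := hx' (f * const Γ₁ (-c)) (by
      rw [mul_const_apply]
      exact add_coe_neg_nonpos_iff.2 h)
    rw [map_mul, hc, mul_const_apply, mul_neg] at h1
    exact add_coe_neg_nonpos_iff.1 h1
  have hge : ∀ (f : RatFun Γ₁), f ≠ 0 → ∀ c : ℝ, (c : EReal) ≤ f x →
      ((r * c : ℝ) : EReal) ≤ ψ f x' := by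
    intro f hf c h
    have hψf : ψ f ≠ 0 := by simpa using hf
    have hinv : ψ (inv f hf) = inv (ψ f) hψf := left_inv_eq_right_inv (a := ψ f)
      (by rw [← map_mul, mul_comm, mul_inv, map_one]) (mul_inv _ _)
    have h1 := hle (inv f hf) (-c) (by
      rw [inv_apply, EReal.coe_neg]
      exact EReal.neg_le_neg_iff.2 h)
    rw [hinv, inv_apply, mul_neg, EReal.coe_neg] at h1
    exact EReal.neg_le_neg_iff.1 h1
  refine ⟨x', fun f => ?_⟩
  by_cases hf : f = 0
  · rw [hf, map_zero, eq_zero_iff.1 rfl, eq_zero_iff.1 rfl, EReal.coe_mul_bot_of_pos hr]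
  have h1 := hle f
  have h2 := hge f hf
  generalize f x = a at h1 h2
  induction a with
  | bot =>
    rw [EReal.coe_mul_bot_of_pos hr, EReal.eq_bot_iff_forall_lt]
    intro c
    refine (h1 ((c - 1) / r) bot_le).trans_lt ?_
    rw [mul_div_cancel₀ _ hr.ne']
    exact_mod_cast sub_one_lt c
  | top =>
    rw [EReal.coe_mul_top_of_pos hr, EReal.eq_top_iff_forall_lt]
    intro c
    refine lt_of_lt_of_le ?_ (h2 ((c + 1) / r) le_top)
    rw [mul_div_cancel₀ _ hr.ne']
    exact_mod_cast lt_add_one c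
  | coe a => exact le_antisymm (h1 a le_rfl) (h2 a le_rfl)

theorem coe_mul_coe_inv_mul {r : ℝ} (hr : 0 < r) (a : EReal) : (r : EReal) * ((r⁻¹ : ℝ) * a) = a := by
  rw [← mul_assoc, ← EReal.coe_mul, mul_inv_cancel₀ hr.ne', EReal.coe_one, one_mul]

theorem coe_inv_mul_coe_mul {r : ℝ} (hr : 0 < r) (a : EReal) : ((r⁻¹ : ℝ) : EReal) * (r * a) = a := by
  rw [← mul_assoc, ← EReal.coe_mul, inv_mul_cancel₀ hr.ne', EReal.coe_one, one_mul]

/-- Passing to `Γ₂` and back preserves every evaluation since the factors `r` and `r⁻¹` cancel, so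
separation of points makes the two maps mutually inverse. -/
theorem exists_isTransport (ψ : RatFun Γ₁ ≃+* RatFun Γ₂) {r : ℝ} (hr : 0 < r)
    (hc : ∀ c, ψ (const Γ₁ c) = const Γ₂ (r * c)) : ∃ φ, IsTransport ψ r φ := by
  have hc' : ∀ c, ψ.symm (const Γ₂ c) = const Γ₁ (r⁻¹ * c) := fun c => by
    rw [RingEquiv.symm_apply_eq, hc, mul_inv_cancel_left₀ hr.ne']
  choose φ hφ using exists_forall_map_eq ψ hr hc
  choose θ hθ using exists_forall_map_eq ψ.symm (inv_pos.2 hr) hc'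
  refine ⟨⟨φ, θ, fun x => ?_, fun y => ?_⟩, hr, fun f x => hφ x f⟩
  · by_contra h
    obtain ⟨f, hf⟩ := exists_ratFun_ne h
    have := hθ (φ x) (ψ f)
    rw [hφ, coe_inv_mul_coe_mul hr, RingEquiv.symm_apply_apply] at this
    exact hf this
  · by_contra h
    obtain ⟨f, hf⟩ := exists_ratFun_ne h
    have := hφ (θ y) (ψ.symm f)
    rw [hθ, coe_mul_coe_inv_mul hr, RingEquiv.apply_symm_apply] at this
    exact hf this

namespace IsTransport

variable {ψ : RatFun Γ₁ ≃+* RatFun Γ₂} {r : ℝ} {φ : Γ₁.Point ≃ Γ₂.Point}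

theorem symm (h : IsTransport ψ r φ) : IsTransport ψ.symm r⁻¹ φ.symm where
  pos := inv_pos.2 h.pos
  apply f x := by
    have := h.apply (ψ.symm f) (φ.symm x)
    rw [φ.apply_symm_apply, ψ.apply_symm_apply] at this
    rw [this, coe_inv_mul_coe_mul h.pos]

/-- At a point at infinity some nonzero function is `⊥`; at a finite point none is. The first
property is transported by `φ`. -/
theorem mem_finite_of_map (h : IsTransport ψ r φ) {x : Γ₁.Point} (hx : φ x ∈ Γ₂.finite) :
    x ∈ Γ₁.finite := by
  rintro ⟨e, he, rfl⟩
  have h1 := h.apply (rayFn he 0) (Point.vertex (Γ₁.tgt e))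
  rw [(rayFn_eq_bot_iff he 0 _).2 rfl, EReal.coe_mul_bot_of_pos h.pos] at h1
  have h2 : rayFn he 0 ≠ 0 := fun h0 => by
    have h3 := eq_zero_iff.1 h0 (Point.vertex (Γ₁.src e))
    exact (leaf_unique he e).1 (Point.vertex.inj ((rayFn_eq_bot_iff he 0 _).1 h3))
  exact ((rational_of_ne_zero (f := ψ (rayFn he 0)) (by simpa using h2)).1 _ hx).1 h1

theorem mem_finite_iff (h : IsTransport ψ r φ) (x : Γ₁.Point) : x ∈ Γ₁.finite ↔ φ x ∈ Γ₂.finite :=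
  ⟨fun hx => h.symm.mem_finite_of_map (by simpa using hx), h.mem_finite_of_map⟩

/-- Evaluating all functions embeds the compact space `Γ₂.Point` into a power of `EReal`, and in
these coordinates `φ` is given by the continuous functions `r * ψ.symm f`. -/
theorem continuous (h : IsTransport ψ r φ) : Continuous φ := by
  let ι : Γ₂.Point → RatFun Γ₂ → EReal := fun x f => f x
  have hι : Topology.IsClosedEmbedding ι :=
    (continuous_pi fun f => f.cont).isClosedEmbedding fun x y hxy => by
      by_contra hne
      obtain ⟨f, hf⟩ := exists_ratFun_ne hne
      exact hf (congrFun hxy f)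
  rw [hι.isEmbedding.continuous_iff, continuous_pi_iff]
  intro f
  have hf : (fun x => ι (φ x) f) = fun x => (r : EReal) * ψ.symm f x := funext fun x => by
    rw [← h.apply, ψ.apply_symm_apply]
  change Continuous fun x => ι (φ x) f
  rw [hf, continuous_iff_continuousAt]
  intro x
  have hr : (r : EReal) ≠ 0 := by exact_mod_cast h.pos.ne'
  exact (EReal.continuousAt_mul (p := ((r : EReal), ψ.symm f x)) (Or.inl hr) (Or.inl hr)
    (Or.inl (EReal.coe_ne_bot r)) (Or.inl (EReal.coe_ne_top r))).comp
    (f := fun x => ((r : EReal), ψ.symm f x)) (continuousAt_const.prodMk (ψ.symm f).cont.continuousAt)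

end IsTransport

end Isomorphism

/-! ### Distances and slopes at finite points -/

section Expansive

open TropicalCurve RatFun

variable {Γ₁ : TropicalCurve.{u, v}} {Γ₂ : TropicalCurve.{u', v'}}

theorem coe_mul_neg_coe {r : ℝ} (hr : 0 < r) (a : ℝ≥0∞) :
    (r : EReal) * (-(a : EReal)) = -((ENNReal.ofReal r * a : ℝ≥0∞) : EReal) := by
  rw [mul_neg, EReal.coe_ennreal_mul, EReal.coe_ennreal_ofReal, max_eq_left hr.le]

theorem neg_coe_le_neg_coe_iff {a b : ℝ≥0∞} : -(a : EReal) ≤ -(b : EReal) ↔ b ≤ a := by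
  rw [EReal.neg_le_neg_iff, EReal.coe_ennreal_le_coe_ennreal_iff]

namespace IsTransport

variable {ψ : RatFun Γ₁ ≃+* RatFun Γ₂} {r : ℝ} {φ : Γ₁.Point ≃ Γ₂.Point}

/-- The image of the truncated distance at `x` has strict maximum `0` at `φ x`, hence lies below a
truncated distance there. -/
theorem exists_min_pdist_le (h : IsTransport ψ r φ) {x : Γ₁.Point} (hx : x ∈ Γ₁.finite) :
    ∃ ε : ℝ≥0, 0 < ε ∧
      ∀ z, min (ε : ℝ≥0∞) (pdist (φ x) (φ z)) ≤ ENNReal.ofReal r * pdist x z := by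
  obtain ⟨S⟩ := nonempty_star hx
  have hψ : ∀ z, ψ S.fn (φ z) =
      -((ENNReal.ofReal r * min (S.ε : ℝ≥0∞) (pdist x z) : ℝ≥0∞) : EReal) := fun z => by
    rw [h.apply, S.fn_eq, coe_mul_neg_coe h.pos]
  obtain ⟨ε, hε, hle⟩ := exists_le_neg_min_pdist ((h.mem_finite_iff x).1 hx) (g := ψ S.fn)
    (by rw [hψ]; simp) (fun z hz => by
      obtain ⟨z, rfl⟩ := φ.surjective z
      have hzx : pdist x z ≠ 0 := fun h0 => hz (by rw [eq_of_pdist_eq_zero hx h0])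
      rw [hψ, EReal.neg_lt_zero, EReal.coe_ennreal_pos]
      exact ENNReal.mul_pos (ENNReal.ofReal_pos.2 h.pos).ne'
        (lt_min (by simpa using S.pos) (pos_iff_ne_zero.2 hzx)).ne')
  refine ⟨ε, hε, fun z => ?_⟩
  have := hle (φ z)
  rw [hψ, neg_coe_le_neg_coe_iff] at this
  exact this.trans (by gcongr; exact min_le_right _ _)

theorem eventually_pdist_map_le (h : IsTransport ψ r φ) {e : Γ₁.E} {c : ℝ≥0}
    (hc : (c : ℝ≥0∞) ≤ Γ₁.len e) : ∀ᶠ d : ℝ≥0 in 𝓝 c, (d : ℝ≥0∞) ≤ Γ₁.len e →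
      pdist (φ (param e c)) (φ (param e d)) ≤
        ENNReal.ofReal r * (((d : ℝ≥0∞) - c) + (c - d)) := by
  obtain ⟨ε, hε, hle⟩ :=
    h.exists_min_pdist_le (param_mem_finite_of_ne_top hc ENNReal.coe_ne_top)
  have hcont : Continuous (fun d : ℝ≥0 => ENNReal.ofReal r * (((d : ℝ≥0∞) - c) + (c - d))) :=
    (ENNReal.continuous_const_mul ENNReal.ofReal_ne_top).comp
      ((continuous_absDiff ENNReal.coe_ne_top).comp ENNReal.continuous_coe)
  have hlt := (hcont.tendsto c).eventually (gt_mem_nhds (show _ < (ε : ℝ≥0∞) by simpa using hε))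
  filter_upwards [hlt] with d hd hdl
  have h1 : ENNReal.ofReal r * pdist (param e c) (param e d) ≤
      ENNReal.ofReal r * (((d : ℝ≥0∞) - c) + (c - d)) := by
    gcongr
    exact (pdist_param_le hc hdl).trans (by rw [add_comm])
  have h2 := (hle (param e d)).trans h1
  rcases min_le_iff.1 h2 with h3 | h3
  · exact absurd hd (not_lt.2 h3)
  · exact h3

/-- The local bound holds on a neighbourhood whose size depends on the point, so it is propagated
along the segment by continuous induction. -/
theorem pdist_map_segment_le (h : IsTransport ψ r φ) {e : Γ₁.E} {a b : ℝ≥0} (hab : a ≤ b)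
    (hb : (b : ℝ≥0∞) ≤ Γ₁.len e) :
    pdist (φ (param e a)) (φ (param e b)) ≤ ENNReal.ofReal r * ((b : ℝ≥0∞) - a) := by
  let S : Set ℝ≥0 := {c | ∀ d, a ≤ d → d ≤ c →
    pdist (φ (param e a)) (φ (param e d)) ≤ ENNReal.ofReal r * ((d : ℝ≥0∞) - a)}
  have hlen : ∀ {c : ℝ≥0}, c ≤ b → (c : ℝ≥0∞) ≤ Γ₁.len e := fun hc =>
    (ENNReal.coe_le_coe.2 hc).trans hb
  -- Lengths add up along a segment, so two consecutive bounds combine through the triangle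
  -- inequality.
  have hstep : ∀ c d : ℝ≥0, a ≤ c → c ≤ d →
      pdist (φ (param e a)) (φ (param e c)) ≤ ENNReal.ofReal r * ((c : ℝ≥0∞) - a) →
      pdist (φ (param e c)) (φ (param e d)) ≤ ENNReal.ofReal r * ((d : ℝ≥0∞) - c) →
      pdist (φ (param e a)) (φ (param e d)) ≤ ENNReal.ofReal r * ((d : ℝ≥0∞) - a) := by
    intro c d hac hcd h1 h2
    refine (pdist_triangle _ (φ (param e c)) _).trans ((add_le_add h1 h2).trans (le_of_eq ?_))
    rw [← mul_add, add_comm,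
      tsub_add_tsub_cancel (ENNReal.coe_le_coe.2 hcd) (ENNReal.coe_le_coe.2 hac)]
  have hclosed : IsClosed (S ∩ Icc a b) := by
    refine isClosed_of_closure_subset fun c hc => ?_
    have hcI : c ∈ Icc a b := closure_minimal inter_subset_right isClosed_Icc hc
    refine ⟨fun d had hdc => ?_, hcI⟩
    rcases hdc.lt_or_eq with hlt | rfl
    · obtain ⟨c', hc', hS, -⟩ := mem_closure_iff_nhds.1 hc _ (Ioi_mem_nhds hlt)
      exact hS d had (le_of_lt hc')
    · obtain ⟨c', hc', hS, hI⟩ :=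
        -- The local bound around the limit point `d` reaches some `c'` where the claim is already
        -- known.
        mem_closure_iff_nhds.1 hc _ (h.eventually_pdist_map_le (hlen hcI.2))
      rcases le_total d c' with hle | hle
      · exact hS d had hle
      · refine hstep c' d hI.1 hle (hS c' hI.1 le_rfl) ?_
        rw [pdist_comm]
        have := hc' (hlen hI.2)
        rwa [tsub_eq_zero_of_le (ENNReal.coe_le_coe.2 hle), zero_add] at this
  have ha : a ∈ S := fun d h1 h2 => by
    rw [le_antisymm h2 h1]
    simp
  have hmem := hclosed.Icc_subset_of_forall_exists_gt ha (fun c hc y hy => by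
    obtain ⟨hS, hac, hcb⟩ := hc
    have hev := (h.eventually_pdist_map_le (hlen hcb.le)).filter_mono
      (nhdsWithin_le_nhds (s := Ioi c))
    obtain ⟨w, hw, hsub⟩ := (mem_nhdsGT_iff_exists_Ioo_subset' hcb).1 hev
    obtain ⟨c₁, h1, h2⟩ := exists_between (lt_min (lt_min hw hcb) hy)
    refine ⟨c₁, fun d had hd => ?_, h1, h2.le.trans (min_le_right _ _)⟩
    rcases le_or_gt d c with hdc | hdc
    · exact hS d had hdc
    · have hdw := hd.trans_lt (h2.trans_le (min_le_left _ _))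
      refine hstep c d hac hdc.le (hS c hac le_rfl) ?_
      have := hsub ⟨hdc, hdw.trans_le (min_le_left _ _)⟩
        (hlen (hdw.trans_le (min_le_right _ _)).le)
      rwa [tsub_eq_zero_of_le (ENNReal.coe_le_coe.2 hdc.le), add_zero] at this)
  exact hmem (right_mem_Icc.2 hab) b hab le_rfl

theorem pdist_map_param_le (h : IsTransport ψ r φ) {e : Γ₁.E} {s t : ℝ≥0∞} (hs : s ≤ Γ₁.len e)
    (ht : t ≤ Γ₁.len e) : pdist (φ (param e s)) (φ (param e t)) ≤
      ENNReal.ofReal r * ((s - t) + (t - s)) := by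
  have hr : ENNReal.ofReal r ≠ 0 := (ENNReal.ofReal_pos.2 h.pos).ne'
  induction s with
  | top =>
    induction t with
    | top => simp
    | coe t => simp [ENNReal.mul_top hr]
  | coe s =>
    induction t with
    | top => simp [ENNReal.mul_top hr]
    | coe t =>
      rcases le_total s t with hst | hst
      · rw [tsub_eq_zero_of_le (ENNReal.coe_le_coe.2 hst), zero_add]
        exact h.pdist_map_segment_le hst ht
      · rw [tsub_eq_zero_of_le (ENNReal.coe_le_coe.2 hst), add_zero, pdist_comm]
        exact h.pdist_map_segment_le hst hs

/-- The function `r⁻¹ * pdist (φ z) (φ y)` of `z` is 1-Lipschitz along edges, hence along all paths,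
and vanishes at `y`. -/
theorem pdist_map_le (h : IsTransport ψ r φ) (x y : Γ₁.Point) :
    pdist (φ x) (φ y) ≤ ENNReal.ofReal r * pdist x y := by
  have hr : ENNReal.ofReal r ≠ 0 := (ENNReal.ofReal_pos.2 h.pos).ne'
  have := le_add_pdist (h := fun z => (ENNReal.ofReal r)⁻¹ * pdist (φ z) (φ y))
    (fun e s t hs ht => by
      have h1 : (ENNReal.ofReal r)⁻¹ * pdist (φ (param e s)) (φ (param e t)) ≤
          (s - t) + (t - s) :=
        (ENNReal.inv_mul_le_iff hr ENNReal.ofReal_ne_top).2 (h.pdist_map_param_le hs ht)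
      refine (mul_le_mul_right (pdist_triangle _ (φ (param e t)) _) _).trans ?_
      rw [mul_add, add_comm]
      gcongr) x y
  rw [pdist_self, mul_zero, zero_add] at this
  exact (ENNReal.inv_mul_le_iff hr ENNReal.ofReal_ne_top).1 this

theorem pdist_map (h : IsTransport ψ r φ) (x y : Γ₁.Point) :
    pdist (φ x) (φ y) = ENNReal.ofReal r * pdist x y := by
  have hr : ENNReal.ofReal r ≠ 0 := (ENNReal.ofReal_pos.2 h.pos).ne'
  refine le_antisymm (h.pdist_map_le x y) ?_
  have := h.symm.pdist_map_le (φ x) (φ y)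
  rw [φ.symm_apply_apply, φ.symm_apply_apply, ENNReal.ofReal_inv_of_pos h.pos] at this
  rw [← ENNReal.div_eq_inv_mul] at this
  exact mul_comm (pdist x y) _ ▸ ENNReal.mul_le_of_le_div this

theorem isExpansive (h : IsTransport ψ r φ) : IsExpansive r φ :=
  ⟨h.continuous, φ.bijective, h.mem_finite_iff, fun x _ y _ => (h.pdist_map x y).symm⟩

/-- The sphere of radius `δ` at `x` goes bijectively onto that of radius `r * δ` at `φ x`, which
pairs up the branches. On paired branches the increment of the function and the radius are both
multiplied by `r`. -/
theorem slopeSum_map_of_finite (h : IsTransport ψ r φ) {f : RatFun Γ₁} (hf : f ≠ 0) {x : Γ₁.Point}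
    (hx : x ∈ Γ₁.finite) : slopeSum (ψ f) (φ x) = slopeSum f x := by
  obtain ⟨S⟩ := nonempty_star hx
  obtain ⟨S'⟩ := nonempty_star ((h.mem_finite_iff x).1 hx)
  obtain ⟨m, hm, η, hη, hs⟩ := S.slopes f hf
  obtain ⟨m', hm', η', hη', hs'⟩ := S'.slopes (ψ f) (by simpa using hf)
  have hr := h.pos
  lift r to ℝ≥0 using hr.le
  have hr' : 0 < r := by exact_mod_cast hr
  -- One radius at which the affine formulas and the sphere descriptions hold on both sides;
  -- division by `r` accounts for the scaling.
  obtain ⟨δ, hδ0, hδ⟩ := exists_between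
    (lt_min (lt_min hη S.pos) (lt_min (div_pos hη' hr') (div_pos S'.pos hr')))
  have hδη : δ < η := hδ.trans_le ((min_le_left _ _).trans (min_le_left _ _))
  have hδε : δ < S.ε := hδ.trans_le ((min_le_left _ _).trans (min_le_right _ _))
  have hδη' : r * δ < η' :=
    (lt_div_iff₀' hr').1 (hδ.trans_le ((min_le_right _ _).trans (min_le_left _ _)))
  have hδε' : r * δ < S'.ε :=
    (lt_div_iff₀' hr').1 (hδ.trans_le ((min_le_right _ _).trans (min_le_right _ _)))
  have hrδ : 0 < r * δ := mul_pos hr' hδ0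
  have hsphere : ∀ z, pdist (φ x) (φ z) = (r * δ : ℝ≥0) ↔ pdist x z = δ := fun z => by
    rw [h.pdist_map, ENNReal.ofReal_coe_nnreal, ENNReal.coe_mul]
    exact ENNReal.mul_right_inj (by exact_mod_cast hr'.ne') ENNReal.coe_ne_top
  have hex : ∀ i, ∃ j, φ (S.γ i δ) = S'.γ j (r * δ) := fun i =>
    (S'.pdist_eq_iff hrδ hδε').1 ((hsphere _).2 ((S.pdist_eq_iff hδ0 hδε).2 ⟨i, rfl⟩))
  choose σ hσ using hex
  have hbij : Function.Bijective σ := by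
    constructor
    · intro i j hij
      refine S.injective δ hδ0 hδε (φ.injective ?_)
      simp only [hσ, hij]
    · intro j
      obtain ⟨z, hz⟩ := φ.surjective (S'.γ j (r * δ))
      obtain ⟨i, rfl⟩ := (S.pdist_eq_iff hδ0 hδε).1
        ((hsphere z).1 ((S'.pdist_eq_iff hrδ hδε').2 ⟨j, hz⟩))
      exact ⟨i, S'.injective _ hrδ hδε' (by simp only [← hσ, hz])⟩
  have hslope : ∀ i, m' (σ i) = m i := fun i => by
    obtain ⟨a, ha⟩ := exists_real_eq hf hx
    have h1 := h.apply f (S.γ i δ)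
    rw [hσ, hs' _ _ hδη', h.apply, hs _ _ hδη, ha, ← EReal.coe_add, ← EReal.coe_mul,
      ← EReal.coe_mul, ← EReal.coe_add, EReal.coe_eq_coe_iff] at h1
    push_cast at h1
    have h2 : ((r : ℝ) * δ) ≠ 0 := by exact_mod_cast hrδ.ne'
    have h3 : (m' (σ i) : ℝ) = m i := mul_right_cancel₀ h2 (by linear_combination h1)
    exact_mod_cast h3
  rw [hm, hm', ← hbij.sum_comp]
  exact Finset.sum_congr rfl fun i _ => hslope i

end IsTransport

/-! ### Behaviour near points at infinity -/

theorem exists_forall_of_eventually_top {P : ℝ≥0∞ → Prop} (h : ∀ᶠ s in 𝓝[<] (⊤ : ℝ≥0∞), P s) :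
    ∃ T : ℝ≥0, ∀ s : ℝ≥0, T < s → P s := by
  obtain ⟨w, hw, hsub⟩ := (mem_nhdsLT_iff_exists_Ioo_subset' ENNReal.zero_lt_top).1 h
  have hw : w < ⊤ := hw
  lift w to ℝ≥0 using hw.ne
  exact ⟨w, fun s hs => hsub ⟨by exact_mod_cast hs, ENNReal.coe_lt_top⟩⟩

/-- The parameter of an infinite edge, extended by `0` as `rayDist e 0`, is 1-Lipschitz, so no path
is a shortcut. -/
theorem sub_le_pdist_param {Γ : TropicalCurve.{u, v}} {e : Γ.E} (he : Γ.len e = ⊤) (s t : ℝ≥0∞) :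
    s - t ≤ pdist (param e s) (param e t) := by
  have h := le_add_pdist (h := rayDist e 0) (fun e' a b ha hb => by
    classical
    rw [rayDist_param he 0 ha, rayDist_param he 0 hb]
    split_ifs
    · simpa using le_add_sub a b
    · simp) (param e s) (param e t)
  rw [rayDist_param_self he, rayDist_param_self he] at h
  exact tsub_le_iff_left.2 (by simpa using h)

theorem pdist_param_of_le {Γ : TropicalCurve.{u, v}} {e : Γ.E} (he : Γ.len e = ⊤) {s t : ℝ≥0∞}
    (h : s ≤ t) : pdist (param e s) (param e t) = t - s := by
  apply le_antisymm
  · have := pdist_param_le (e := e) (s := s) (t := t) (by simp [he]) (by simp [he])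
    rwa [tsub_eq_zero_of_le h, zero_add] at this
  · rw [pdist_comm]
    exact sub_le_pdist_param he t s

theorem abs_sub_eq_of_pdist {Γ : TropicalCurve.{u, v}} {e : Γ.E} (he : Γ.len e = ⊤) {s t d : ℝ≥0}
    (h : pdist (param e s) (param e t) = d) : |(s : ℝ) - t| = d := by
  rcases le_total s t with hst | hst
  · rw [pdist_param_of_le he (ENNReal.coe_le_coe.2 hst), ← ENNReal.coe_sub, ENNReal.coe_inj] at h
    rw [← h, NNReal.coe_sub hst, abs_sub_comm, abs_of_nonneg]
    exact sub_nonneg.2 (by exact_mod_cast hst)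
  · rw [pdist_comm, pdist_param_of_le he (ENNReal.coe_le_coe.2 hst), ← ENNReal.coe_sub,
      ENNReal.coe_inj] at h
    rw [← h, NNReal.coe_sub hst, abs_of_nonneg]
    exact sub_nonneg.2 (by exact_mod_cast hst)

open Classical in
theorem slopeSum_infinite {Γ : TropicalCurve.{u, v}} {e : Γ.E} (he : Γ.len e = ⊤) (f : RatFun Γ) :
    slopeSum f (Point.vertex (Γ.tgt e)) = slopeBwd f e ⊤ := by
  rw [slopeSum, Finset.sum_eq_zero, Finset.sum_eq_single e, he, zero_add]
  · intro e' h hne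
    rw [Finset.mem_filter_univ] at h
    exact absurd ((leaf_unique he e').2 h) hne
  · intro h
    rw [Finset.mem_filter_univ] at h
    exact absurd rfl h
  · intro e' h
    rw [Finset.mem_filter_univ] at h
    exact absurd h (leaf_unique he e').1

namespace IsTransport

variable {ψ : RatFun Γ₁ ≃+* RatFun Γ₂} {r : ℝ} {φ : Γ₁.Point ≃ Γ₂.Point}

/-- Near a point at infinity, `φ` is affine with slope `r`. -/
theorem exists_affine_near_infinite (h : IsTransport ψ r φ) {e : Γ₁.E} (he : Γ₁.len e = ⊤) :
    ∃ e' : Γ₂.E, Γ₂.len e' = ⊤ ∧ φ (Point.vertex (Γ₁.tgt e)) = Point.vertex (Γ₂.tgt e') ∧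
      ∃ (T : ℝ≥0) (b : ℝ), ∀ s : ℝ≥0, T < s →
        ∃ w : ℝ≥0, (w : ℝ) = r * s + b ∧ φ (param e s) = param e' w := by
  have hinf : φ (Point.vertex (Γ₁.tgt e)) ∉ Γ₂.finite := fun hfin =>
    (h.mem_finite_iff _).2 hfin ⟨e, he, rfl⟩
  obtain ⟨e', he', hφ⟩ := not_not.1 hinf
  refine ⟨e', he', hφ, ?_⟩
  -- On `e'`, `rayFn he' 0` is minus the parameter. Its preimage under `ψ` is rational, hence
  -- eventually affine on `e`, and so expresses the parameter of `φ (param e s)` in terms of `s`.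
  have hk : ∀ z, ψ.symm (rayFn he' 0) z = ((r⁻¹ : ℝ) : EReal) * rayFn he' 0 (φ z) := fun z => by
    have := h.symm.apply (rayFn he' 0) (φ z)
    rwa [φ.symm_apply_apply] at this
  have hk0 : ψ.symm (rayFn he' 0) ≠ 0 := fun h0 => by
    have h1 : rayFn he' 0 = 0 := by simpa using h0
    have h3 := eq_zero_iff.1 h1 (Point.vertex (Γ₂.src e'))
    exact (leaf_unique he' e').1 (Point.vertex.inj ((rayFn_eq_bot_iff he' 0 _).1 h3))
  obtain ⟨m, c, hmc⟩ := ((rational_of_ne_zero hk0).2 e).eventually he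
  -- Negativity places the image point on `e'`: away from that edge `rayFn he' 0` is zero.
  have hneg : ∀ᶠ s in 𝓝[<] (⊤ : ℝ≥0∞), ψ.symm (rayFn he' 0) (param e s) < 0 := by
    have hcont := (ψ.symm (rayFn he' 0)).continuousOn_param e ⊤ ⟨zero_le, by simp [he]⟩
    have hlim : Tendsto (fun s => ψ.symm (rayFn he' 0) (param e s)) (𝓝[<] ⊤)
        (𝓝 (ψ.symm (rayFn he' 0) (param e ⊤))) :=
      Tendsto.mono_left hcont (nhdsWithin_mono _ fun s hs => ⟨zero_le, by simp [he]⟩)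
    refine hlim.eventually (gt_mem_nhds ?_)
    rw [param_top he, hk, hφ, (rayFn_eq_bot_iff he' 0 _).2 rfl,
      EReal.coe_mul_bot_of_pos (inv_pos.2 h.pos)]
    exact EReal.bot_lt_zero
  obtain ⟨T, hT⟩ := exists_forall_of_eventually_top (hmc.and hneg)
  have hT' : ∀ s : ℝ≥0, T < s →
      ∃ w : ℝ≥0, (w : ℝ) = -r * (m * s + c) ∧ φ (param e s) = param e' w := by
    intro s hs
    obtain ⟨h1, h2⟩ := hT s hs
    have h3 : rayFn he' 0 (φ (param e s)) = (((r * (m * s + c) : ℝ)) : EReal) := by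
      have := h.apply (ψ.symm (rayFn he' 0)) (param e s)
      rw [ψ.apply_symm_apply] at this
      rw [this, h1, EReal.coe_mul]
      rfl
    have hd0 : rayDist e' 0 (φ (param e s)) ≠ 0 := fun h0 => by
      rw [hk, rayFn_apply, h0] at h2
      simp at h2
    obtain ⟨t, -, ht⟩ := exists_of_rayDist_ne_zero he' hd0
    rw [rayFn_apply, ht, rayDist_param_self he', ENNReal.coe_zero, tsub_zero] at h3
    induction t with
    | top =>
      rw [EReal.coe_ennreal_top, EReal.neg_top] at h3
      exact absurd h3.symm (EReal.coe_ne_bot _)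
    | coe t =>
      refine ⟨t, ?_, ht⟩
      rw [coe_coe_ereal, ← EReal.coe_neg, EReal.coe_eq_coe_iff] at h3
      linarith
  have hrpos := h.pos
  have hm0 : m ≤ 0 := by
    by_contra hm
    have hm1 : (1 : ℝ) ≤ m := by exact_mod_cast not_le.1 hm
    -- A parameter large enough for `m * s + c > 0` when `m ≥ 1`; the image parameter `w` would then
    -- be negative.
    have h1 : T < T + 1 + Real.toNNReal (-c) :=
      (lt_add_one T).trans_le le_self_add
    obtain ⟨w, hw, -⟩ := hT' _ h1
    push_cast at hw
    have h2 := Real.le_coe_toNNReal (-c)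
    have h3 : (0 : ℝ) < m * (T + 1 + (Real.toNNReal (-c) : ℝ)) + c := by
      have h4 : (0 : ℝ) ≤ T := T.2
      have h5 : (0 : ℝ) ≤ (Real.toNNReal (-c) : ℝ) := NNReal.coe_nonneg _
      nlinarith
    have h6 : (0 : ℝ) ≤ w := w.2
    nlinarith
  -- Two points at distance `1` have images at distance `r`, which fixes `|m| = 1`.
  have hm1 : (m : ℝ) = -1 := by
    obtain ⟨w₁, hw₁, hp₁⟩ := hT' (T + 1) (lt_add_one T)
    obtain ⟨w₂, hw₂, hp₂⟩ := hT' (T + 2) (lt_add_of_pos_right T two_pos)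
    have h1 := h.pdist_map (param e ((T + 1 : ℝ≥0) : ℝ≥0∞)) (param e ((T + 2 : ℝ≥0) : ℝ≥0∞))
    have h2 : T + 1 ≤ T + 2 := by gcongr; exact one_le_two
    rw [hp₁, hp₂, pdist_param_of_le he (ENNReal.coe_le_coe.2 h2), ← ENNReal.coe_sub] at h1
    have h3 : T + 2 - (T + 1) = 1 := by
      rw [add_tsub_add_eq_tsub_left]
      exact tsub_eq_of_eq_add one_add_one_eq_two.symm
    rw [h3, ENNReal.coe_one, mul_one] at h1
    have h4 := abs_sub_eq_of_pdist he' h1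
    rw [Real.coe_toNNReal _ hrpos.le, hw₁, hw₂] at h4
    push_cast at h4
    have h5 : -r * (m * (T + 1) + c) - -r * (m * (T + 2) + c) = r * m := by ring
    rw [h5, abs_mul, abs_of_pos hrpos, abs_of_nonpos (by exact_mod_cast hm0)] at h4
    have h6 : r * (-(m : ℝ) - 1) = 0 := by linarith
    rcases mul_eq_zero.1 h6 with h7 | h7 <;> linarith
  refine ⟨T, -r * c, fun s hs => ?_⟩
  obtain ⟨w, hw, hp⟩ := hT' s hs
  exact ⟨w, by rw [hw, hm1]; ring, hp⟩

/-- Only one edge contributes at a leaf. Far out, `f` and `ψ f` are affine in parameters related by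
`s ↦ r * s + b`, so comparing values at two parameters equates the slopes. -/
theorem slopeSum_map_of_infinite (h : IsTransport ψ r φ) {f : RatFun Γ₁} (hf : f ≠ 0) {e : Γ₁.E}
    (he : Γ₁.len e = ⊤) : slopeSum (ψ f) (φ (Point.vertex (Γ₁.tgt e))) =
      slopeSum f (Point.vertex (Γ₁.tgt e)) := by
  obtain ⟨e', he', hφ, T, b, hT⟩ := h.exists_affine_near_infinite he
  rw [hφ, slopeSum_infinite he, slopeSum_infinite he']
  obtain ⟨c, hc⟩ := isSlopeBwd_slopeBwd hf ENNReal.zero_lt_top (by simp [he] : ⊤ ≤ Γ₁.len e)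
  obtain ⟨c', hc'⟩ := isSlopeBwd_slopeBwd (f := ψ f) (by simpa using hf) ENNReal.zero_lt_top
    (by simp [he'] : ⊤ ≤ Γ₂.len e')
  obtain ⟨T₁, hT₁⟩ := exists_forall_of_eventually_top hc
  obtain ⟨T₂, hT₂⟩ := exists_forall_of_eventually_top hc'
  generalize slopeBwd f e ⊤ = m at hT₁
  generalize slopeBwd (ψ f) e' ⊤ = m' at hT₂
  have hrpos := h.pos
  have key : ∀ s : ℝ≥0, T < s → T₁ < s → (T₂ : ℝ) < r * s + b →
      -(m' : ℝ) * (r * s + b) + c' = r * (-m * s + c) := by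
    intro s h1 h2 h3
    obtain ⟨w, hw, hp⟩ := hT s h1
    have h4 := h.apply f (param e s)
    rw [hp, hT₁ s h2, hT₂ w (by rw [← NNReal.coe_lt_coe, hw]; exact h3), ← EReal.coe_mul,
      EReal.coe_eq_coe_iff, ENNReal.coe_toReal, ENNReal.coe_toReal, hw] at h4
    exact h4
  have hlarge : ∀ᶠ s : ℝ≥0 in atTop, T < s ∧ T₁ < s ∧ (T₂ : ℝ) < r * s + b := by
    refine (eventually_gt_atTop T).and ((eventually_gt_atTop T₁).and ?_)
    have : Tendsto (fun s : ℝ≥0 => r * (s : ℝ) + b) atTop atTop :=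
      tendsto_atTop_add_const_right _ b
        ((NNReal.tendsto_coe_atTop.2 tendsto_id).const_mul_atTop hrpos)
    exact this.eventually_gt_atTop _
  obtain ⟨s, hs1, hs2, hs3⟩ := hlarge.exists
  obtain ⟨t, ⟨ht1, ht2, ht3⟩, hst⟩ := (hlarge.and (eventually_gt_atTop s)).exists
  have hst' : (t : ℝ) - s ≠ 0 := (sub_pos.2 (by exact_mod_cast hst : (s : ℝ) < t)).ne'
  have h1 := key s hs1 hs2 hs3
  have h2 := key t ht1 ht2 ht3
  have h3 : (m' : ℝ) = m := mul_right_cancel₀ (mul_ne_zero hrpos.ne' hst')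
    (by linear_combination h1 - h2)
  exact_mod_cast h3

theorem slopeSum_map (h : IsTransport ψ r φ) {f : RatFun Γ₁} (hf : f ≠ 0) (x : Γ₁.Point) :
    slopeSum (ψ f) (φ x) = slopeSum f x := by
  by_cases hx : x ∈ Γ₁.finite
  · exact h.slopeSum_map_of_finite hf hx
  · obtain ⟨e, he, rfl⟩ := not_not.1 hx
    exact h.slopeSum_map_of_infinite hf he

/-! ### Existence and uniqueness of the induced map -/

theorem isInducedMap (h : IsTransport ψ r φ) : IsInducedMap ψ r φ := by
  refine ⟨fun x hx => ⟨(h.mem_finite_iff x).1 hx, ?_⟩, fun e he => ?_⟩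
  · obtain ⟨S⟩ := nonempty_star hx
    refine ⟨S.ε, S.pos, S.fn, fun z => ?_, fun z => ?_⟩
    · rw [S.fn_eq, distTo_singleton, ENNReal.ofReal_coe_nnreal]
    · obtain ⟨z, rfl⟩ := φ.surjective z
      rw [h.apply, S.fn_eq, distTo_singleton, coe_mul_neg_coe h.pos, h.pdist_map,
        ENNReal.ofReal_mul h.pos.le, ENNReal.ofReal_coe_nnreal, mul_min]
  · obtain ⟨e', he', hφ, T, b, hT⟩ := h.exists_affine_near_infinite he
    have hrpos := h.pos
    -- Starting the ray beyond `T` puts all of its finite points in the region where `φ` is affine.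
    obtain ⟨w, hw, hp⟩ := hT (T + 1) (lt_add_one T)
    refine ⟨e', he', hφ, T + 1, w, hp, rayFn he (T + 1), fun z => ?_, fun z => ?_⟩
    · rw [rayFn_apply, distTo_compl_ray he, min_eq_right le_top]
    obtain ⟨z, rfl⟩ := φ.surjective z
    rw [h.apply, rayFn_apply, distTo_compl_ray he', min_eq_right le_top, coe_mul_neg_coe hrpos]
    congr 2
    by_cases hz : z ∈ ray e (T + 1)
    · obtain ⟨t, ht, rfl⟩ := hz
      rw [rayDist_param_self he]
      induction t with
      | top =>
        rw [param_top he, hφ, ← param_top he', rayDist_param_self he', ENNReal.top_sub_coe,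
          ENNReal.top_sub_coe, ENNReal.mul_top (ENNReal.ofReal_pos.2 hrpos).ne']
      | coe t =>
        have ht : T + 1 < t := by exact_mod_cast ht
        obtain ⟨w', hw', hp'⟩ := hT t ((lt_add_one T).trans ht)
        have htr : ((T + 1 : ℝ≥0) : ℝ) < t := by exact_mod_cast ht
        have hww : w ≤ w' := by
          rw [← NNReal.coe_le_coe, hw, hw']
          nlinarith
        rw [hp', rayDist_param_self he', ENNReal.ofReal, ← ENNReal.coe_sub, ← ENNReal.coe_sub,
          ← ENNReal.coe_mul, ENNReal.coe_inj, ← NNReal.coe_inj, NNReal.coe_mul,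
          NNReal.coe_sub hww, NNReal.coe_sub ht.le, Real.coe_toNNReal _ hrpos.le, hw, hw']
        ring
    -- Outside the ray both sides must vanish. A point of the target ray with finite parameter `w'`
    -- is the image of the point at `T + 1 + (w' - w) / r`, and its infinite end comes from the
    -- infinite end, so injectivity would put `z` on the ray.
    · rw [(rayDist_eq_zero_iff he).2 hz, mul_zero, eq_comm, rayDist_eq_zero_iff he']
      rintro ⟨w', hw', hz'⟩
      apply hz
      induction w' with
      | top =>
        rw [param_top he', ← hφ] at hz'
        exact ⟨⊤, ENNReal.coe_lt_top, by rw [param_top he]; exact φ.injective hz'⟩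
      | coe w' =>
        have hw' : w < w' := by exact_mod_cast hw'
        have hwr : (w : ℝ) < w' := by exact_mod_cast hw'
        have hq : 0 < ((w' : ℝ) - w) / r := div_pos (sub_pos.2 hwr) hrpos
        have hlt : T + 1 < T + 1 + Real.toNNReal (((w' : ℝ) - w) / r) :=
          lt_add_of_pos_right _ (Real.toNNReal_pos.2 hq)
        obtain ⟨w'', hw'', hp''⟩ := hT _ ((lt_add_one T).trans hlt)
        have heq : w'' = w' := by
          rw [← NNReal.coe_inj, hw'', NNReal.coe_add, Real.coe_toNNReal _ hq.le, mul_add,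
            mul_div_cancel₀ _ hrpos.ne']
          linarith
        refine ⟨_, ENNReal.coe_lt_coe.2 hlt, φ.injective ?_⟩
        rw [hz', hp'', heq]

/-- Transport says that the image chip-firing move takes at `φ x` the extreme value `0` (for finite
`x`) or `⊥` (at infinity), which it attains only at `θ x`. -/
theorem eq_of_isInducedMap (h : IsTransport ψ r φ) {θ : Γ₁.Point → Γ₂.Point}
    (hθ : IsInducedMap ψ r θ) : θ = φ := by
  funext x
  by_cases hx : x ∈ Γ₁.finite
  · obtain ⟨hfin, ε, hε, g, hg, hg'⟩ := hθ.1 x hx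
    have h1 := h.apply g x
    rw [hg', hg, distTo_singleton, distTo_singleton, pdist_self, coe_mul_neg_coe h.pos, neg_inj,
      EReal.coe_ennreal_eq_coe_ennreal_iff, min_eq_right zero_le, mul_zero, ← bot_eq_zero,
      min_eq_bot, bot_eq_zero] at h1
    rcases h1 with h1 | h1
    · exact absurd h1 (ENNReal.ofReal_pos.2 (mul_pos h.pos hε)).ne'
    · exact (eq_of_pdist_eq_zero hfin h1).symm
  · obtain ⟨e, he, rfl⟩ := not_not.1 hx
    obtain ⟨e', he', hθe, s, s', -, g, hg, hg'⟩ := hθ.2 e he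
    have h1 := h.apply g (Point.vertex (Γ₁.tgt e))
    rw [hg', hg, distTo_compl_ray he, distTo_compl_ray he', min_eq_right le_top,
      min_eq_right le_top, ← rayFn_apply he, ← rayFn_apply he', (rayFn_eq_bot_iff he _ _).2 rfl,
      EReal.coe_mul_bot_of_pos h.pos, rayFn_eq_bot_iff] at h1
    rw [hθe, h1]

end IsTransport

end Expansive

/-! ### Conclusion -/

theorem corollary3 (Γ₁ : TropicalCurve.{u, v}) (Γ₂ : TropicalCurve.{u', v'})
    (ψ : RatFun Γ₁ ≃+* RatFun Γ₂) :
    ∃ r : ℝ, 0 < r ∧ ψ (RatFun.const Γ₁ 1) = RatFun.const Γ₂ r ∧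
      (∃! φ : Γ₁.Point → Γ₂.Point, IsInducedMap ψ r φ) ∧
      ∀ φ : Γ₁.Point → Γ₂.Point, IsInducedMap ψ r φ →
        IsExpansive r φ ∧
        ∀ f : RatFun Γ₁, f ≠ 0 → ∀ x : Γ₁.Point,
          (f.IsZeroAt x ↔ (ψ f).IsZeroAt (φ x)) ∧
          (f.IsPoleAt x ↔ (ψ f).IsPoleAt (φ x)) ∧
          f.degreeAt x = (ψ f).degreeAt (φ x) := by
  obtain ⟨r, hr, hc⟩ := exists_scale ψ
  obtain ⟨φ, hφ⟩ := exists_isTransport ψ hr hc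
  refine ⟨r, hr, by rw [hc, mul_one],
    ⟨φ, hφ.isInducedMap, fun θ hθ => hφ.eq_of_isInducedMap hθ⟩, fun θ hθ => ?_⟩
  rw [hφ.eq_of_isInducedMap hθ]
  refine ⟨hφ.isExpansive, fun f hf x => ?_⟩
  unfold RatFun.IsZeroAt RatFun.IsPoleAt RatFun.degreeAt
  rw [hφ.slopeSum_map hf x]
  exact ⟨Iff.rfl, Iff.rfl, rfl⟩
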